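/- Terms of the $\lambda\Pi$-calculus are $t ::= x \mid \mathit{Type} \mid \mathit{Kind} \mid \Pi x{:}t\,t \mid \lambda x{:}t\,t \mid t\,t$, identified modulo $\alpha$-equivalence; $A\to B$ stands for $\Pi x{:}A\,B$ when $x$ does not occur in $B$. Given a finite list $\Sigma$ of typed constants and a set ${\cal R}$ of rewrite rules, the $\lambda\Pi$-calculus modulo $\Sigma,{\cal R}$ has the typing rules (where $s$ is $\mathit{Type}$ or $\mathit{Kind}$): the empty context is well-formed; if $\Gamma\vdash A:s$ and $x$ is not in $\Sigma,\Gamma$, then $\Gamma,x{:}A$ is well-formed; if $\Gamma$ is well-formed, then $\Gamma\vdash \mathit{Type}:\mathit{Kind}$ and $\Gamma\vdash x:A$ for each $x{:}A\in\Sigma,\Gamma$; if $\Gamma\vdash A:\mathit{Type}$ and $\Gamma,x{:}A\vdash B:s$, then $\Gamma\vdash\Pi x{:}A\,B:s$, and if moreover $\Gamma,x{:}A\vdash t:B$, then $\Gamma\vdash\lambda x{:}A\,t:\Pi x{:}A\,B$; if $\Gamma\vdash t:\Pi x{:}A\,B$ and $\Gamma\vdash u:A$, then $\Gamma\vdash (t\,u):(u/x)B$;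 if $\Gamma\vdash A:s$, $\Gamma\vdash B:s$, $\Gamma\vdash t:A$ and $A\equiv_{\beta{\cal R}}B$, then $\Gamma\vdash t:B$. Here $\equiv_{\beta{\cal R}}$ is the reflexive-symmetric-transitive closure, on all terms, of the subterm extension of root $\beta$-reduction together with the pairs $(\theta l,\theta r)$ for a rule $l\longrightarrow r$ of ${\cal R}$ and a substitution $\theta$ of the variables of the rule. Simple types are generated from $\iota$ and $o$ by $\to$. For a finite set $S$ of Simple types, *Simple type theory* is the theory with constants $\iota:\mathit{Type}$, $o:\mathit{Type}$, $\varepsilon:o\to \mathit{Type}$, $\dot\Rightarrow:o\to o\to o$ and $\dot\forall_A:(A\to o)\to o$ for $A\in S$, and rules $\varepsilon(\dot\Rightarrow X\,Y)\longrightarrow\varepsilon(X)\to\varepsilon(Y)$ and $\varepsilon(\dot\forall_A X)\longrightarrow\Pi z{:}A\,\varepsilon(X\,z)$ for $A\in S$. The *Calculus of constructions* is the theory with constants $U_{\mathit{Type}}:\mathit{Type}$, $U_{\mathit{Kind}}:\mathit{Type}$, $\dot{\mathit{Type}}:U_{\mathit{Kind}}$, $\varepsilon_{s}:U_{s}\to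 \mathit{Type}$ for $s\in\{\mathit{Type},\mathit{Kind}\}$, and $\dot\Pi_{\langle s_1,s_2,s_2\rangle}:\Pi X{:}U_{s_1}\,(((\varepsilon_{s_1}X)\to U_{s_2})\to U_{s_2})$ for $s_1,s_2\in\{\mathit{Type},\mathit{Kind}\}$, and rules $\varepsilon_{\mathit{Kind}}(\dot{\mathit{Type}})\longrightarrow U_{\mathit{Type}}$ and $\varepsilon_{s_2}(\dot\Pi_{\langle s_1,s_2,s_2\rangle}X\,Y)\longrightarrow \Pi z{:}(\varepsilon_{s_1}X)\,(\varepsilon_{s_2}(Y\,z))$ for $s_1,s_2\in\{\mathit{Type},\mathit{Kind}\}$. **Lemma (Consistency).** (1) For every finite set $S$ of Simple types, in the $\lambda\Pi$-calculus modulo Simple type theory there is no term of type $\varepsilon(x)$ in the context $x:o$. (2) In the $\lambda\Pi$-calculus modulo the Calculus of constructions there is no term of type $\varepsilon_{\mathit{Type}}(x)$ in the context $x:U_{\mathit{Type}}$. -/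

import Mathlib

namespace LambdaPi

/-- The two sorts `Type` and `Kind`. -/
inductive Srt where
  | type
  | kind

/-- Terms of the `λΠ`-calculus up to `α`-equivalence: variables are de Bruijn indices, and the
variables declared in the signature of a theory (the constants) are kept apart, as names in `C`. -/
inductive Tm (C : Type) where
  | var (n : ℕ)
  | const (c : C)
  | sort (s : Srt)
  | pi (A B : Tm C)
  | lam (A t : Tm C)
  | app (t u : Tm C)

namespace Tm

variable {C : Type}

/-- Lift a renaming under one binder. -/
def upr (f : ℕ → ℕ) : ℕ → ℕ
  | 0 => 0
  | n + 1 => f n + 1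

def rename : (ℕ → ℕ) → Tm C → Tm C
  | f, var n => var (f n)
  | _, const c => const c
  | _, sort s => sort s
  | f, pi A B => pi (rename f A) (rename (upr f) B)
  | f, lam A t => lam (rename f A) (rename (upr f) t)
  | f, app t u => app (rename f t) (rename f u)

/-- Lift a substitution under one binder. -/
def ups (σ : ℕ → Tm C) : ℕ → Tm C
  | 0 => var 0
  | n + 1 => rename Nat.succ (σ n)

/-- Simultaneous capture-avoiding substitution. -/
def subst : (ℕ → Tm C) → Tm C → Tm C
  | σ, var n => σ n
  | _, const c => const c
  | _, sort s => sort s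
  | σ, pi A B => pi (subst σ A) (subst (ups σ) B)
  | σ, lam A t => lam (subst σ A) (subst (ups σ) t)
  | σ, app t u => app (subst σ t) (subst σ u)

/-- The substitution sending the variable `0` to `u` and lowering the others. -/
def single (u : Tm C) : ℕ → Tm C
  | 0 => u
  | n + 1 => var n

/-- `inst t u` is `(u/x)t`, where `x` is the variable `0` of `t`. -/
def inst (t u : Tm C) : Tm C := subst (single u) t

/-- `A → B`, that is `Π x:A B` where `x` does not occur in `B`. -/
def arrow (A B : Tm C) : Tm C := pi A (rename Nat.succ B)

end Tm

variable {C : Type}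

/-- One step `β`-reduction at the root. -/
inductive Beta : Tm C → Tm C → Prop
  | beta (A t u : Tm C) : Beta (.app (.lam A t) u) (t.inst u)

/-- The subterm extension of a relation on terms. -/
inductive Step (r : Tm C → Tm C → Prop) : Tm C → Tm C → Prop
  | root {t u : Tm C} : r t u → Step r t u
  | piLeft {A A' B : Tm C} : Step r A A' → Step r (.pi A B) (.pi A' B)
  | piRight {A B B' : Tm C} : Step r B B' → Step r (.pi A B) (.pi A B')
  | lamLeft {A A' t : Tm C} : Step r A A' → Step r (.lam A t) (.lam A' t)
  | lamRight {A t t' : Tm C} : Step r t t' → Step r (.lam A t) (.lam A t')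
  | appLeft {t t' u : Tm C} : Step r t t' → Step r (.app t u) (.app t' u)
  | appRight {t u u' : Tm C} : Step r u u' → Step r (.app t u) (.app t u')

def BetaNormal (t : Tm C) : Prop := ∀ u, ¬ Step Beta t u

/-- A context; the most recent declaration comes first, and each type lives in the context formed
by the declarations that follow it in the list. -/
abbrev Ctx (C : Type) := List (Tm C)

/-- A signature: the declarations of the constants, the most recent one first. -/
abbrev Sig (C : Type) := List (C × Tm C)

/-- A rewrite rule `lhs ⟶^{ctx, ty} rhs`. -/
structure RewriteRule (C : Type) where
  ctx : Ctx C
  ty : Tm C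
  lhs : Tm C
  rhs : Tm C

/-- One step `R`-reduction at the root. -/
def Rewrite (R : Set (RewriteRule C)) (t u : Tm C) : Prop :=
  ∃ ρ ∈ R, ∃ θ : ℕ → Tm C, t = ρ.lhs.subst θ ∧ u = ρ.rhs.subst θ

/-- One step `βR`-reduction at the root. -/
def BetaRewrite (R : Set (RewriteRule C)) (t u : Tm C) : Prop :=
  Beta t u ∨ Rewrite R t u

/-- The congruence `≡_{βR}` on (raw) terms. -/
def Conv (R : Set (RewriteRule C)) : Tm C → Tm C → Prop :=
  Relation.EqvGen (Step (BetaRewrite R))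

mutual

/-- `Γ well-formed`, with constants from `Sg` and conversion `≡_{βR}`. -/
inductive WF (Sg : Sig C) (R : Set (RewriteRule C)) : Ctx C → Prop
  | empty : WF Sg R []
  | decl {Γ : Ctx C} {A : Tm C} {s : Srt} : HasType Sg R Γ A (.sort s) → WF Sg R (A :: Γ)

/-- `Γ ⊢ t : A`, with constants from `Sg` and conversion `≡_{βR}`. -/
inductive HasType (Sg : Sig C) (R : Set (RewriteRule C)) : Ctx C → Tm C → Tm C → Prop
  | sort {Γ : Ctx C} : WF Sg R Γ → HasType Sg R Γ (.sort .type) (.sort .kind)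
  | var {Γ : Ctx C} {n : ℕ} {A : Tm C} : WF Sg R Γ → Γ[n]? = some A →
      HasType Sg R Γ (.var n) (A.rename (· + (n + 1)))
  | const {Γ : Ctx C} {c : C} {A : Tm C} : WF Sg R Γ → (c, A) ∈ Sg →
      HasType Sg R Γ (.const c) A
  | pi {Γ : Ctx C} {A B : Tm C} {s : Srt} : HasType Sg R Γ A (.sort .type) →
      HasType Sg R (A :: Γ) B (.sort s) → HasType Sg R Γ (.pi A B) (.sort s)
  | lam {Γ : Ctx C} {A B t : Tm C} {s : Srt} : HasType Sg R Γ A (.sort .type) →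
      HasType Sg R (A :: Γ) B (.sort s) → HasType Sg R (A :: Γ) t B →
      HasType Sg R Γ (.lam A t) (.pi A B)
  | app {Γ : Ctx C} {A B t u : Tm C} : HasType Sg R Γ t (.pi A B) → HasType Sg R Γ u A →
      HasType Sg R Γ (.app t u) (B.inst u)
  | conv {Γ : Ctx C} {A B t : Tm C} {s : Srt} : HasType Sg R Γ A (.sort s) →
      HasType Sg R Γ B (.sort s) → HasType Sg R Γ t A → Conv R A B → HasType Sg R Γ t B

end

/-- The signature is a well-formed context of the (pure) `λΠ`-calculus. -/
inductive SigWF : Sig C → Prop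
  | empty : SigWF []
  | decl {Sg : Sig C} {c : C} {A : Tm C} {s : Srt} : SigWF Sg → (∀ B, (c, B) ∉ Sg) →
      HasType Sg ∅ [] A (.sort s) → SigWF ((c, A) :: Sg)

namespace RewriteRule

/-- The three terms of the rule are `β`-normal. -/
def Normal (ρ : RewriteRule C) : Prop :=
  BetaNormal ρ.lhs ∧ BetaNormal ρ.rhs ∧ BetaNormal ρ.ty

/-- The rule is well-typed in the signature `Sg`, in the (pure) `λΠ`-calculus. -/
def WellTyped (Sg : Sig C) (ρ : RewriteRule C) : Prop :=
  WF Sg ∅ ρ.ctx ∧ HasType Sg ∅ ρ.ctx ρ.lhs ρ.ty ∧ HasType Sg ∅ ρ.ctx ρ.rhs ρ.ty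

end RewriteRule

/-- A theory in the `λΠ`-calculus modulo theory. -/
structure Theory (C : Type) where
  sig : Sig C
  rules : Set (RewriteRule C)
  sig_wf : SigWF sig
  rules_normal : ∀ ρ ∈ rules, ρ.Normal
  rules_wellTyped : ∀ ρ ∈ rules, ρ.WellTyped sig

/-- `Γ ⊢ t : A` in the `λΠ`-calculus modulo the theory `T`. -/
def Theory.Typed (T : Theory C) (Γ : Ctx C) (t A : Tm C) : Prop :=
  HasType T.sig T.rules Γ t A

/-! ### Facts used to check that the two examples below are theories -/

theorem BetaNormal.var (n : ℕ) : BetaNormal (Tm.var n : Tm C) := by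
  rintro u (h | _); cases h

theorem BetaNormal.const (c : C) : BetaNormal (Tm.const c) := by
  rintro u (h | _); cases h

theorem BetaNormal.sort (s : Srt) : BetaNormal (Tm.sort s : Tm C) := by
  rintro u (h | _); cases h

theorem BetaNormal.pi {A B : Tm C} (hA : BetaNormal A) (hB : BetaNormal B) :
    BetaNormal (Tm.pi A B) := by
  intro u h
  cases h with
  | root h => cases h
  | piLeft h => exact hA _ h
  | piRight h => exact hB _ h

theorem BetaNormal.app {t u : Tm C} (ht : BetaNormal t) (hu : BetaNormal u)
    (hl : ∀ A b, t ≠ Tm.lam A b) : BetaNormal (Tm.app t u) := by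
  intro v h
  cases h with
  | root h => cases h; exact hl _ _ rfl
  | appLeft h => exact ht _ h
  | appRight h => exact hu _ h

theorem HasType.app_of_eq {Sg : Sig C} {R : Set (RewriteRule C)} {Γ : Ctx C} {A B D t u : Tm C}
    (ht : HasType Sg R Γ t (.pi A B)) (hu : HasType Sg R Γ u A) (h : B.inst u = D) :
    HasType Sg R Γ (.app t u) D := h ▸ HasType.app ht hu

theorem HasType.var_of_eq {Sg : Sig C} {R : Set (RewriteRule C)} {Γ : Ctx C} {n : ℕ} {A D : Tm C}
    (hΓ : WF Sg R Γ) (h : Γ[n]? = some A) (hD : A.rename (· + (n + 1)) = D) :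
    HasType Sg R Γ (.var n) D := hD ▸ HasType.var hΓ h

/-! ### Simple type theory -/

/-- Simple types. -/
inductive SimpleType where
  | iota
  | o
  | arrow (A B : SimpleType)

/-- The names of the constants of Simple type theory. -/
inductive STTConst where
  | iota
  | o
  | eps
  | imp
  | all (A : SimpleType)

namespace STT

open Tm

def iota : Tm STTConst := const .iota
def o : Tm STTConst := const .o
def eps (t : Tm STTConst) : Tm STTConst := app (const .eps) t
def imp (t u : Tm STTConst) : Tm STTConst := app (app (const .imp) t) u
def all (A : SimpleType) (t : Tm STTConst) : Tm STTConst := app (const (.all A)) t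

/-- A Simple type as a term. -/
def ofType : SimpleType → Tm STTConst
  | .iota => iota
  | .o => o
  | .arrow A B => arrow (ofType A) (ofType B)

def baseSig : Sig STTConst :=
  [(.imp, arrow o (arrow o o)), (.eps, arrow o (sort .type)),
    (.o, sort .type), (.iota, sort .type)]

def allDecl (A : SimpleType) : STTConst × Tm STTConst :=
  (.all A, arrow (arrow (ofType A) o) o)

/-- The language of Simple type theory, with the quantifiers `∀_A` for `A ∈ S`. -/
noncomputable def sig (S : Finset SimpleType) : Sig STTConst :=
  S.toList.map allDecl ++ baseSig

/-- `ε(⇒ X Y) ⟶ ε(X) → ε(Y)`, in the context `X : o, Y : o`. -/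
def impRule : RewriteRule STTConst where
  ctx := [o, o]
  ty := sort .type
  lhs := eps (imp (var 1) (var 0))
  rhs := arrow (eps (var 1)) (eps (var 0))

/-- `ε(∀_A X) ⟶ Π z:A ε(X z)`, in the context `X : A → o`. -/
def allRule (A : SimpleType) : RewriteRule STTConst where
  ctx := [arrow (ofType A) o]
  ty := sort .type
  lhs := eps (all A (var 0))
  rhs := pi (ofType A) (eps (app (var 1) (var 0)))

def rules (S : Finset SimpleType) : Set (RewriteRule STTConst) :=
  insert impRule (allRule '' S)

theorem rename_ofType (A : SimpleType) (f : ℕ → ℕ) : (ofType A).rename f = ofType A := by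
  induction A generalizing f with
  | iota => rfl
  | o => rfl
  | arrow A B ihA ihB => simp [ofType, arrow, rename, ihA, ihB]

theorem normal_ofType (A : SimpleType) : BetaNormal (ofType A) := by
  induction A with
  | iota => exact .const _
  | o => exact .const _
  | arrow A B ihA ihB =>
    refine .pi ihA ?_
    rw [rename_ofType]
    exact ihB

section
variable {Sg : Sig STTConst} {R : Set (RewriteRule STTConst)} {Γ : Ctx STTConst}

theorem hasType_o (h : baseSig.tail.tail ⊆ Sg) (hΓ : WF Sg R Γ) :
    HasType Sg R Γ o (sort .type) := .const hΓ (h (by simp [baseSig]))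

theorem hasType_ofType (h : baseSig.tail.tail ⊆ Sg) (A : SimpleType) (hΓ : WF Sg R Γ) :
    HasType Sg R Γ (ofType A) (sort .type) := by
  induction A generalizing Γ with
  | iota => exact .const hΓ (h (by simp [baseSig]))
  | o => exact .const hΓ (h (by simp [baseSig]))
  | arrow A B ihA ihB =>
    refine .pi (ihA hΓ) ?_
    rw [rename_ofType]
    exact ihB (.decl (ihA hΓ))

theorem hasType_eps (h : baseSig.tail ⊆ Sg) {t : Tm STTConst} (hΓ : WF Sg R Γ)
    (ht : HasType Sg R Γ t o) : HasType Sg R Γ (eps t) (sort .type) :=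
  .app_of_eq (.const hΓ (h (by simp [baseSig]; rfl))) ht rfl

end

theorem sig_wf_aux (l : List SimpleType) (hl : l.Nodup) : SigWF (l.map allDecl ++ baseSig) := by
  induction l with
  | nil =>
    have o_ty {Sg R} {Γ : Ctx STTConst} (h : baseSig.tail.tail ⊆ Sg) (hΓ : WF Sg R Γ) :=
      hasType_o h hΓ
    refine .decl (s := .type) (.decl (s := .kind) (.decl (s := .kind) (.decl (s := .kind)
      .empty (by simp) (.sort .empty)) (by simp) (.sort .empty)) (by simp) ?_) (by simp) ?_
    · have h0 := o_ty (Sg := baseSig.tail.tail) (R := ∅) (fun _ h => h) .empty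
      exact .pi h0 (.sort (.decl h0))
    · have hs : baseSig.tail.tail ⊆ baseSig.tail := List.tail_subset _
      have h0 := o_ty (R := ∅) hs .empty
      have h1 := o_ty hs (.decl h0)
      exact .pi h0 (.pi h1 (o_ty hs (.decl h1)))
  | cons A l ih =>
    have hs : baseSig.tail.tail ⊆ l.map allDecl ++ baseSig := fun x hx =>
      List.mem_append_right _ (List.mem_of_mem_tail (List.mem_of_mem_tail hx))
    rw [List.nodup_cons] at hl
    refine .decl (s := .type) (ih hl.2) ?_ ?_
    · intro B hB
      rcases List.mem_append.1 hB with hB | hB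
      · obtain ⟨A', hA', he⟩ := List.mem_map.1 hB
        simp only [allDecl, Prod.mk.injEq, STTConst.all.injEq] at he
        exact hl.1 (he.1 ▸ hA')
      · simp [baseSig] at hB
    · have hA := hasType_ofType (R := ∅) hs A .empty
      have hAo := hasType_ofType (R := ∅) hs (.arrow A .o) .empty
      exact .pi hAo (hasType_o hs (.decl hAo))

theorem base_subset (S : Finset SimpleType) : baseSig ⊆ sig S := fun _ h =>
  List.mem_append_right _ h

theorem rules_normal (S : Finset SimpleType) : ∀ ρ ∈ rules S, ρ.Normal := by
  rintro ρ (rfl | ⟨A, _, rfl⟩)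
  · exact ⟨.app (.const _) (.app (.app (.const _) (.var _) (by simp)) (.var _) (by simp)) (by simp),
      .pi (.app (.const _) (.var _) (by simp))
        (.app (.const _) (.var _) (fun _ _ h => by cases h)), .sort _⟩
  · exact ⟨.app (.const _) (.app (.const _) (.var _) (by simp)) (by simp),
      .pi (normal_ofType A) (.app (.const _) (.app (.var _) (.var _) (by simp)) (by simp)),
      .sort _⟩

theorem rules_wellTyped (S : Finset SimpleType) : ∀ ρ ∈ rules S, ρ.WellTyped (sig S) := by
  have hb := base_subset S
  have hb1 : baseSig.tail ⊆ sig S := fun _ h => hb (List.mem_of_mem_tail h)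
  have hb2 : baseSig.tail.tail ⊆ sig S := fun _ h => hb1 (List.mem_of_mem_tail h)
  rintro ρ (rfl | ⟨A, hA, rfl⟩)
  · have w1 := WF.decl (hasType_o (R := ∅) hb2 .empty)
    have w2 := WF.decl (hasType_o hb2 w1)
    have hX : HasType (sig S) ∅ [o, o] (var 1) o := .var_of_eq w2 rfl rfl
    have hY : HasType (sig S) ∅ [o, o] (var 0) o := .var_of_eq w2 rfl rfl
    have hi : HasType (sig S) ∅ [o, o] (const .imp) (arrow o (arrow o o)) :=
      .const w2 (hb (by simp [baseSig]))
    refine ⟨w2, hasType_eps hb1 w2 (.app_of_eq (.app_of_eq hi hX rfl) hY rfl), ?_⟩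
    have hE := hasType_eps hb1 w2 hX
    have w3 := WF.decl hE
    exact .pi hE (hasType_eps hb1 w3 (.var_of_eq w3 rfl rfl))
  · have hAo := hasType_ofType (R := ∅) hb2 (.arrow A .o) .empty
    have w1 := WF.decl hAo
    have hq : HasType (sig S) ∅ [ofType (.arrow A .o)] (const (.all A))
        (arrow (arrow (ofType A) o) o) :=
      .const w1 (List.mem_append_left _ (List.mem_map.2 ⟨A, Finset.mem_toList.2 hA, rfl⟩))
    refine ⟨w1, hasType_eps hb1 w1 (.app_of_eq hq (.var_of_eq w1 rfl
      (rename_ofType (.arrow A .o) _)) rfl), ?_⟩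
    have hA' := hasType_ofType hb2 A w1
    have w2 := WF.decl hA'
    exact .pi hA' (hasType_eps hb1 w2 (.app_of_eq (.var_of_eq w2 rfl
      (rename_ofType (.arrow A .o) _)) (.var_of_eq w2 rfl (rename_ofType A _)) rfl))

/-- Simple type theory, with the quantifiers `∀_A` for `A ∈ S`. -/
noncomputable def theory (S : Finset SimpleType) : Theory STTConst where
  sig := sig S
  rules := rules S
  sig_wf := sig_wf_aux _ S.nodup_toList
  rules_normal := rules_normal S
  rules_wellTyped := rules_wellTyped S

end STT

/-! ### The Calculus of constructions -/

/-- The names of the constants of the embedding of the Calculus of constructions: `U_s`, the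
constant `Type` of type `U_Kind`, `ε_s`, and `Π_⟨s₁,s₂,s₂⟩`. -/
inductive CCConst where
  | U (s : Srt)
  | dotType
  | eps (s : Srt)
  | dotPi (s₁ s₂ : Srt)

namespace CC

open Tm

def U (s : Srt) : Tm CCConst := const (.U s)
def dotType : Tm CCConst := const .dotType
def eps (s : Srt) (t : Tm CCConst) : Tm CCConst := app (const (.eps s)) t
def dotPi (s₁ s₂ : Srt) (t u : Tm CCConst) : Tm CCConst := app (app (const (.dotPi s₁ s₂)) t) u

/-- The type `Π X:U_{s₁} (((ε_{s₁} X) → U_{s₂}) → U_{s₂})` of `Π_⟨s₁,s₂,s₂⟩`. -/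
def dotPiType (s₁ s₂ : Srt) : Tm CCConst :=
  pi (U s₁) (arrow (arrow (eps s₁ (var 0)) (U s₂)) (U s₂))

def baseSig : Sig CCConst :=
  [(.eps .kind, arrow (U .kind) (sort .type)), (.eps .type, arrow (U .type) (sort .type)),
    (.dotType, U .kind), (.U .kind, sort .type), (.U .type, sort .type)]

/-- The language of the Calculus of constructions. -/
def sig : Sig CCConst :=
  (.dotPi .kind .kind, dotPiType .kind .kind) :: (.dotPi .kind .type, dotPiType .kind .type) ::
  (.dotPi .type .kind, dotPiType .type .kind) :: (.dotPi .type .type, dotPiType .type .type) ::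
  baseSig

/-- `ε_Kind(Type) ⟶ U_Type`, in the empty context. -/
def dotTypeRule : RewriteRule CCConst where
  ctx := []
  ty := sort .type
  lhs := eps .kind dotType
  rhs := U .type

/-- `ε_{s₂}(Π_⟨s₁,s₂,s₂⟩ X Y) ⟶ Π z:(ε_{s₁} X) (ε_{s₂} (Y z))`, in the context
`X : U_{s₁}, Y : (ε_{s₁} X) → U_{s₂}`. -/
def dotPiRule (s₁ s₂ : Srt) : RewriteRule CCConst where
  ctx := [arrow (eps s₁ (var 0)) (U s₂), U s₁]
  ty := sort .type
  lhs := eps s₂ (dotPi s₁ s₂ (var 1) (var 0))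
  rhs := pi (eps s₁ (var 1)) (eps s₂ (app (var 1) (var 0)))

def rules : Set (RewriteRule CCConst) :=
  {dotTypeRule, dotPiRule .type .type, dotPiRule .type .kind, dotPiRule .kind .type,
    dotPiRule .kind .kind}

section
variable {Sg : Sig CCConst} {R : Set (RewriteRule CCConst)} {Γ : Ctx CCConst}

theorem hasType_U (h : baseSig.tail.tail.tail ⊆ Sg) (s : Srt) (hΓ : WF Sg R Γ) :
    HasType Sg R Γ (U s) (sort .type) := .const hΓ (h (by cases s <;> simp [baseSig]))

theorem hasType_eps (h : baseSig ⊆ Sg) (s : Srt) {t : Tm CCConst} (hΓ : WF Sg R Γ)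
    (ht : HasType Sg R Γ t (U s)) : HasType Sg R Γ (eps s t) (sort .type) :=
  .app_of_eq (A := U s) (B := sort .type)
    (.const hΓ (h (by cases s <;> simp [baseSig] <;> rfl))) ht rfl

theorem hasType_dotPiType (h : baseSig ⊆ Sg) (s₁ s₂ : Srt) (hΓ : WF Sg R Γ) :
    HasType Sg R Γ (dotPiType s₁ s₂) (sort .type) := by
  have hu : baseSig.tail.tail.tail ⊆ Sg := fun x hx =>
    h (List.mem_of_mem_tail (List.mem_of_mem_tail (List.mem_of_mem_tail hx)))
  have hU := hasType_U hu s₁ hΓ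
  have w1 := WF.decl hU
  have hE := hasType_eps h s₁ (t := var 0) w1 (.var_of_eq w1 rfl rfl)
  have hY : HasType Sg R (U s₁ :: Γ) (arrow (eps s₁ (var 0)) (U s₂)) (sort .type) :=
    .pi hE (hasType_U hu s₂ (.decl hE))
  exact .pi hU (.pi hY (hasType_U hu s₂ (.decl hY)))

end

theorem sig_wf : SigWF sig := by
  have hU {Sg : Sig CCConst} (h : baseSig.tail.tail.tail ⊆ Sg) (s : Srt) :=
    hasType_U (R := ∅) h s .empty
  have h3 : baseSig.tail.tail.tail ⊆ baseSig.tail.tail := List.tail_subset _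
  have h2 : baseSig.tail.tail.tail ⊆ baseSig.tail := fun _ hx => List.mem_of_mem_tail (h3 hx)
  have hb : SigWF baseSig := by
    refine .decl (s := .kind) (.decl (s := .kind) (.decl (s := .type) (.decl (s := .kind)
      (.decl (s := .kind) .empty (by simp) (.sort .empty)) (by simp) (.sort .empty)) (by simp)
      (hU (List.Subset.refl _) .kind)) (by simp) ?_) (by simp) ?_
    · exact .pi (hU h3 .type) (.sort (.decl (hU h3 .type)))
    · exact .pi (hU h2 .kind) (.sort (.decl (hU h2 .kind)))
  refine .decl (.decl (.decl (.decl hb ?_ (hasType_dotPiType ?_ _ _ .empty))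
    ?_ (hasType_dotPiType ?_ _ _ .empty)) ?_ (hasType_dotPiType ?_ _ _ .empty))
    ?_ (hasType_dotPiType ?_ _ _ .empty)
  all_goals first
    | (intro B hB; simp [baseSig] at hB; done)
    | (intro x hx; simp only [List.mem_cons]; tauto)
    | exact fun _ h => h

theorem base_subset : baseSig ⊆ sig := by
  intro x hx
  simp only [sig, List.mem_cons]
  tauto

theorem normal_dotPiRule (s₁ s₂ : Srt) : (dotPiRule s₁ s₂).Normal :=
  ⟨.app (.const _) (.app (.app (.const _) (.var _) (by simp)) (.var _) (by simp)) (by simp),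
    .pi (.app (.const _) (.var _) (by simp))
      (.app (.const _) (.app (.var _) (.var _) (by simp)) (by simp)), .sort _⟩

theorem wellTyped_dotPiRule (s₁ s₂ : Srt) : (dotPiRule s₁ s₂).WellTyped sig := by
  have hb := base_subset
  have hu : baseSig.tail.tail.tail ⊆ sig := fun x hx =>
    hb (List.mem_of_mem_tail (List.mem_of_mem_tail (List.mem_of_mem_tail hx)))
  have w1 := WF.decl (hasType_U (R := ∅) hu s₁ .empty)
  have hE := hasType_eps hb s₁ (t := var 0) w1 (.var_of_eq w1 rfl rfl)
  have w2 : WF sig ∅ [arrow (eps s₁ (var 0)) (U s₂), U s₁] :=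
    .decl (s := .type) (.pi hE (hasType_U hu s₂ (.decl hE)))
  have hp : HasType sig ∅ [arrow (eps s₁ (var 0)) (U s₂), U s₁] (const (.dotPi s₁ s₂))
      (dotPiType s₁ s₂) := .const w2 (by cases s₁ <;> cases s₂ <;> simp [sig])
  refine ⟨w2, hasType_eps hb s₂ w2 (.app_of_eq (.app_of_eq hp (.var_of_eq w2 rfl rfl) rfl)
    (.var_of_eq w2 rfl rfl) rfl), ?_⟩
  have hE2 := hasType_eps hb s₁ w2 (.var_of_eq (n := 1) w2 rfl rfl)
  have w3 := WF.decl hE2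
  exact .pi hE2 (hasType_eps hb s₂ w3
    (.app_of_eq (A := eps s₁ (var 2)) (B := U s₂) (.var_of_eq w3 rfl rfl)
      (.var_of_eq w3 rfl rfl) rfl))

theorem rules_normal : ∀ ρ ∈ rules, ρ.Normal := by
  rintro ρ (rfl | rfl | rfl | rfl | rfl)
  · exact ⟨.app (.const _) (.const _) (fun _ _ h => by cases h), .const _, .sort _⟩
  all_goals exact normal_dotPiRule _ _

theorem rules_wellTyped : ∀ ρ ∈ rules, ρ.WellTyped sig := by
  rintro ρ (rfl | rfl | rfl | rfl | rfl)
  · exact ⟨.empty, hasType_eps base_subset .kind .empty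
      (.const .empty (by simp [sig, baseSig])),
      .const .empty (by simp [sig, baseSig, dotTypeRule])⟩
  all_goals exact wellTyped_dotPiRule _ _

/-- The theory embedding the Calculus of constructions. -/
def theory : Theory CCConst where
  sig := sig
  rules := rules
  sig_wf := sig_wf
  rules_normal := rules_normal
  rules_wellTyped := rules_wellTyped

end CC

end LambdaPi

/-!
Consistency of the Calculus of constructions is shown by a model in which every type has a truth
value, every inhabited type is true, and `ε_Type(x)` is false when `x` is. Consistency of Simple type
theory follows, because `STT.toCC` translates it into the Calculus of constructions: `ι` and `o`
become `U_Type`, the implication a product over a constant family, and `∀_A` the product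
`Π_⟨Kind,Type,Type⟩` applied to the code of `A` in `U_Kind`.

The obstacle to a direct interpretation is the conversion rule. A conversion may pass through
ill-typed terms, on which no set-theoretic model is sound, so invariance of an interpretation is
established along the reductions of well-typed terms only: reduction is confluent
(`CC.Reds.confluent`), typing is preserved by reduction (`CC.Typ.red`), and hence convertible typed
terms reduce to a common typed term (`CC.Typ.conv_induction`). But invariance under `β`-reduction of a
typed redex uses that the value of the argument belongs to the interpretation of its type, which is
proved by induction on typing and so uses invariance for types in the case of the conversion rule.
The circle is broken by interpreting terms in layers, such that the membership statement of a layer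
only needs the invariance of the layer below:

* the *shape* of a type depends on no valuation, and its invariance holds on all terms that
  respect the stratification into objects, families and kinds (`CC.Stratified.red`);
* the *carrier* of a term of type `A` is an element of the shape of `A` (`CC.Typ.carrier_mem`); the
  carrier of a type is a set;
* the *value* of a term of type `A` is an element of the carrier of `A` (`CC.Typ.value_mem`); the
  value of a type is a truth value. The value of a product `Π x:A B` is true when, if `A` is true,
  `B` is true for all values of `x`.

Soundness (`CC.Typ.value_eq_true`) is then a last induction on typing, which needs the invariance of
values. Since propositions are impredicative, a product of types that carry no information must again
carry no information, on the nose: this holds because functions are coded in Aczel's way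
(`ZF.pi_unit`).
-/

namespace LambdaPi

/-! ### Renaming and substitution -/

namespace Tm

variable {C : Type}

theorem upr_comp (f g : ℕ → ℕ) : upr g ∘ upr f = upr (g ∘ f) := by
  funext n; cases n <;> rfl

theorem upr_id : upr id = id := by
  funext n; cases n <;> rfl

theorem rename_id (t : Tm C) : t.rename id = t := by
  induction t <;> simp_all [rename, upr_id]

theorem rename_rename (t : Tm C) (f g : ℕ → ℕ) :
    (t.rename f).rename g = t.rename (g ∘ f) := by
  induction t generalizing f g <;> simp_all [rename, upr_comp]

theorem ups_comp_upr (f : ℕ → ℕ) (σ : ℕ → Tm C) : ups σ ∘ upr f = ups (σ ∘ f) := by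
  funext n; cases n <;> rfl

theorem subst_rename (t : Tm C) (f : ℕ → ℕ) (σ : ℕ → Tm C) :
    (t.rename f).subst σ = t.subst (σ ∘ f) := by
  induction t generalizing f σ <;> simp_all [rename, subst, ups_comp_upr]

theorem rename_upr_ups (f : ℕ → ℕ) (σ : ℕ → Tm C) :
    (fun n => (ups σ n).rename (upr f)) = ups fun n => (σ n).rename f := by
  funext n
  cases n with
  | zero => rfl
  | succ n => simp only [ups, rename_rename]; rfl

theorem rename_subst (t : Tm C) (f : ℕ → ℕ) (σ : ℕ → Tm C) :
    (t.subst σ).rename f = t.subst fun n => (σ n).rename f := by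
  induction t generalizing f σ <;> simp_all [rename, subst, rename_upr_ups]

theorem subst_ups_ups (σ τ : ℕ → Tm C) :
    (fun n => (ups σ n).subst (ups τ)) = ups fun n => (σ n).subst τ := by
  funext n
  cases n with
  | zero => rfl
  | succ n => simp only [ups, subst_rename, rename_subst]; rfl

theorem subst_subst (t : Tm C) (σ τ : ℕ → Tm C) :
    (t.subst σ).subst τ = t.subst fun n => (σ n).subst τ := by
  induction t generalizing σ τ <;> simp_all [subst, subst_ups_ups]

theorem ups_var_comp (f : ℕ → ℕ) : ups (fun n => (var (f n) : Tm C)) = fun n => var (upr f n) := by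
  funext n; cases n <;> rfl

theorem rename_eq_subst (t : Tm C) (f : ℕ → ℕ) : t.rename f = t.subst fun n => var (f n) := by
  induction t generalizing f <;> simp_all [rename, subst, ups_var_comp]

theorem subst_var (t : Tm C) : t.subst var = t := by
  exact (rename_eq_subst t id).symm.trans (rename_id t)

theorem inst_rename (t u : Tm C) (f : ℕ → ℕ) :
    (t.inst u).rename f = (t.rename (upr f)).inst (u.rename f) := by
  simp only [inst, rename_subst, subst_rename]
  congr 1; funext n; cases n <;> rfl

theorem rename_succ_inst (t u : Tm C) : (t.rename Nat.succ).inst u = t := by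
  rw [inst, subst_rename]
  exact subst_var t

theorem inst_subst (t u : Tm C) (σ : ℕ → Tm C) :
    (t.inst u).subst σ = (t.subst (ups σ)).inst (u.subst σ) := by
  simp only [inst, subst_subst]
  congr 1; funext n
  cases n with
  | zero => rfl
  | succ n => exact (rename_succ_inst _ _).symm

theorem subst_rename_succ (t : Tm C) (σ : ℕ → Tm C) :
    (t.rename Nat.succ).subst (ups σ) = (t.subst σ).rename Nat.succ := by
  rw [subst_rename, rename_subst]; rfl

theorem rename_succ_upr (t : Tm C) (f : ℕ → ℕ) :
    (t.rename Nat.succ).rename (upr f) = (t.rename f).rename Nat.succ := by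
  rw [rename_rename, rename_rename]; rfl

end Tm

open Tm

variable {C : Type} {R : Set (RewriteRule C)}

/-! ### Conversion -/

namespace Conv

theorem refl (t : Tm C) : Conv R t t :=
  Relation.EqvGen.refl t

theorem symm {t u : Tm C} (h : Conv R t u) : Conv R u t :=
  Relation.EqvGen.symm _ _ h

theorem trans {t u v : Tm C} (h : Conv R t u) (h' : Conv R u v) : Conv R t v :=
  Relation.EqvGen.trans _ _ _ h h'

theorem step {t u : Tm C} (h : Step (BetaRewrite R) t u) : Conv R t u :=
  Relation.EqvGen.rel _ _ h

/-- A map on terms that sends steps to conversions preserves conversion. -/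
theorem map {D : Type} {R' : Set (RewriteRule D)} {f : Tm C → Tm D}
    (hf : ∀ t u, Step (BetaRewrite R) t u → Conv R' (f t) (f u)) {t u : Tm C}
    (h : Conv R t u) : Conv R' (f t) (f u) := by
  induction h with
  | rel t u h => exact hf t u h
  | refl t => exact refl _
  | symm t u _ ih => exact ih.symm
  | trans t u v _ _ ih ih' => exact ih.trans ih'

theorem pi {A A' B B' : Tm C} (hA : Conv R A A') (hB : Conv R B B') :
    Conv R (.pi A B) (.pi A' B') :=
  (map (f := fun X => .pi X B) (fun _ _ h => step (.piLeft h)) hA).trans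
    (map (fun _ _ h => step (.piRight h)) hB)

theorem lam {A A' t t' : Tm C} (hA : Conv R A A') (ht : Conv R t t') :
    Conv R (.lam A t) (.lam A' t') :=
  (map (f := fun X => .lam X t) (fun _ _ h => step (.lamLeft h)) hA).trans
    (map (fun _ _ h => step (.lamRight h)) ht)

theorem app {t t' u u' : Tm C} (ht : Conv R t t') (hu : Conv R u u') :
    Conv R (.app t u) (.app t' u') :=
  (map (f := fun X => .app X u) (fun _ _ h => step (.appLeft h)) ht).trans
    (map (fun _ _ h => step (.appRight h)) hu)

theorem beta (A t u : Tm C) : Conv R (.app (.lam A t) u) (t.inst u) :=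
  step (.root (.inl (.beta A t u)))

end Conv

theorem Step.subst {t u : Tm C} (h : Step (BetaRewrite R) t u) (σ : ℕ → Tm C) :
    Step (BetaRewrite R) (t.subst σ) (u.subst σ) := by
  induction h generalizing σ with
  | root h =>
    refine .root ?_
    rcases h with ⟨A, t, u⟩ | ⟨ρ, hρ, θ, rfl, rfl⟩
    · rw [inst_subst]
      exact .inl (.beta _ _ _)
    · exact .inr ⟨ρ, hρ, _, subst_subst _ _ _, subst_subst _ _ _⟩
  | piLeft _ ih => exact .piLeft (ih σ)
  | piRight _ ih => exact .piRight (ih _)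
  | lamLeft _ ih => exact .lamLeft (ih σ)
  | lamRight _ ih => exact .lamRight (ih _)
  | appLeft _ ih => exact .appLeft (ih σ)
  | appRight _ ih => exact .appRight (ih σ)

theorem Conv.subst {t u : Tm C} (h : Conv R t u) (σ : ℕ → Tm C) :
    Conv R (t.subst σ) (u.subst σ) :=
  Conv.map (fun _ _ h => .step (h.subst σ)) h

theorem Conv.rename {t u : Tm C} (h : Conv R t u) (f : ℕ → ℕ) :
    Conv R (t.rename f) (u.rename f) := by
  simpa only [rename_eq_subst] using h.subst _

theorem Conv.inst_left {t t' : Tm C} (h : Conv R t t') (u : Tm C) :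
    Conv R (t.inst u) (t'.inst u) := h.subst _

theorem Conv.subst_right (t : Tm C) {σ τ : ℕ → Tm C} (h : ∀ n, Conv R (σ n) (τ n)) :
    Conv R (t.subst σ) (t.subst τ) := by
  have up : ∀ {σ τ : ℕ → Tm C}, (∀ n, Conv R (σ n) (τ n)) → ∀ n, Conv R (ups σ n) (ups τ n) :=
    fun h n => match n with
      | 0 => .refl _
      | n + 1 => (h n).rename _
  induction t generalizing σ τ with
  | var n => exact h n
  | const c => exact .refl _
  | sort s => exact .refl _
  | pi A B ihA ihB => exact .pi (ihA h) (ihB (up h))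
  | lam A t ihA iht => exact .lam (ihA h) (iht (up h))
  | app t u iht ihu => exact .app (iht h) (ihu h)

theorem Conv.inst_right (t : Tm C) {u u' : Tm C} (h : Conv R u u') :
    Conv R (t.inst u) (t.inst u') :=
  Conv.subst_right t fun n => match n with
    | 0 => h
    | _ + 1 => .refl _

namespace CC

/-! ### Confluence for the Calculus of constructions -/

/-- One step reduction in the theory of the Calculus of constructions. -/
abbrev Red : Tm CCConst → Tm CCConst → Prop := Step (BetaRewrite rules)

/-- The instances of the rewrite rules, with the two sides computed. -/
inductive Root : Tm CCConst → Tm CCConst → Prop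
  | dotType : Root (eps .kind dotType) (U .type)
  | dotPi (s₁ s₂ : Srt) (X Y : Tm CCConst) : Root (eps s₂ (dotPi s₁ s₂ X Y))
      (pi (eps s₁ X) (eps s₂ (app (Y.rename Nat.succ) (var 0))))

theorem rewrite_iff {t u : Tm CCConst} : Rewrite rules t u ↔ Root t u := by
  constructor
  · rintro ⟨ρ, rfl | rfl | rfl | rfl | rfl, θ, rfl, rfl⟩
    · exact .dotType
    all_goals exact .dotPi _ _ (θ 1) (θ 0)
  · rintro (_ | ⟨s₁, s₂, X, Y⟩)
    · exact ⟨dotTypeRule, .inl rfl, var, rfl, rfl⟩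
    · refine ⟨dotPiRule s₁ s₂, ?_, fun n => match n with | 0 => Y | _ + 1 => X, rfl, rfl⟩
      cases s₁ <;> cases s₂ <;> simp [rules]

theorem Root.red {t u : Tm CCConst} (h : Root t u) : Red t u :=
  .root (.inr (rewrite_iff.2 h))

/-- Parallel reduction. -/
inductive Par : Tm CCConst → Tm CCConst → Prop
  | var (n : ℕ) : Par (var n) (var n)
  | const (c : CCConst) : Par (const c) (const c)
  | sort (s : Srt) : Par (sort s) (sort s)
  | pi {A A' B B' : Tm CCConst} : Par A A' → Par B B' → Par (pi A B) (pi A' B')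
  | lam {A A' t t' : Tm CCConst} : Par A A' → Par t t' → Par (lam A t) (lam A' t')
  | app {t t' u u' : Tm CCConst} : Par t t' → Par u u' → Par (app t u) (app t' u')
  | beta (A : Tm CCConst) {t t' u u' : Tm CCConst} : Par t t' → Par u u' →
      Par (app (lam A t) u) (t'.inst u')
  | dotType : Par (app (const (.eps .kind)) (const .dotType)) (const (.U .type))
  | dotPi (s₁ s₂ : Srt) {X X' Y Y' : Tm CCConst} : Par X X' → Par Y Y' →
      Par (app (const (.eps s₂)) (app (app (const (.dotPi s₁ s₂)) X) Y))
        (pi (eps s₁ X') (eps s₂ (app (Y'.rename Nat.succ) (var 0))))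

namespace Par

theorem refl (t : Tm CCConst) : Par t t := by
  induction t with
  | var n => exact .var n
  | const c => exact .const c
  | sort s => exact .sort s
  | pi _ _ ihA ihB => exact .pi ihA ihB
  | lam _ _ ihA iht => exact .lam ihA iht
  | app _ _ iht ihu => exact .app iht ihu

theorem of_red {t u : Tm CCConst} (h : Red t u) : Par t u := by
  induction h with
  | root h =>
    rcases h with ⟨A, t, u⟩ | h
    · exact .beta A (refl t) (refl u)
    · rcases rewrite_iff.1 h with _ | ⟨s₁, s₂, X, Y⟩
      · exact .dotType
      · exact .dotPi s₁ s₂ (refl X) (refl Y)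
  | piLeft _ ih => exact .pi ih (refl _)
  | piRight _ ih => exact .pi (refl _) ih
  | lamLeft _ ih => exact .lam ih (refl _)
  | lamRight _ ih => exact .lam (refl _) ih
  | appLeft _ ih => exact .app ih (refl _)
  | appRight _ ih => exact .app (refl _) ih

end Par

open Relation (ReflTransGen)

/-- Reduction in any number of steps. -/
abbrev Reds : Tm CCConst → Tm CCConst → Prop := ReflTransGen Red

namespace Reds

theorem pi {A A' B B' : Tm CCConst} (hA : Reds A A') (hB : Reds B B') :
    Reds (pi A B) (pi A' B') :=
  (hA.lift (fun X => Tm.pi X B) fun _ _ => .piLeft).trans (hB.lift _ fun _ _ => .piRight)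

theorem lam {A A' t t' : Tm CCConst} (hA : Reds A A') (ht : Reds t t') :
    Reds (lam A t) (lam A' t') :=
  (hA.lift (fun X => Tm.lam X t) fun _ _ => .lamLeft).trans (ht.lift _ fun _ _ => .lamRight)

theorem app {t t' u u' : Tm CCConst} (ht : Reds t t') (hu : Reds u u') :
    Reds (app t u) (app t' u') :=
  (ht.lift (fun X => Tm.app X u) fun _ _ => .appLeft).trans (hu.lift _ fun _ _ => .appRight)

theorem conv {t u : Tm CCConst} (h : Reds t u) : Conv rules t u := by
  induction h with
  | refl => exact .refl _
  | tail _ h ih => exact ih.trans (.step h)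

end Reds

namespace Par

theorem reds {t u : Tm CCConst} (h : Par t u) : Reds t u := by
  induction h with
  | var n => exact .refl
  | const c => exact .refl
  | sort s => exact .refl
  | pi _ _ ihA ihB => exact ihA.pi ihB
  | lam _ _ ihA iht => exact ihA.lam iht
  | app _ _ iht ihu => exact iht.app ihu
  | beta A _ _ iht ihu =>
    exact (Reds.app (Reds.lam (.refl : Reds A A) iht) ihu).tail (.root (.inl (.beta _ _ _)))
  | dotType => exact .single Root.dotType.red
  | dotPi s₁ s₂ _ _ ihX ihY =>
    exact (Reds.app .refl (Reds.app (Reds.app .refl ihX) ihY)).tail (Root.dotPi s₁ s₂ _ _).red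

theorem rename {t u : Tm CCConst} (h : Par t u) (f : ℕ → ℕ) : Par (t.rename f) (u.rename f) := by
  induction h generalizing f with
  | var n => exact .var _
  | const c => exact .const c
  | sort s => exact .sort s
  | pi _ _ ihA ihB => exact .pi (ihA f) (ihB _)
  | lam _ _ ihA iht => exact .lam (ihA f) (iht _)
  | app _ _ iht ihu => exact .app (iht f) (ihu f)
  | beta A _ _ iht ihu =>
    rw [inst_rename]
    exact .beta _ (iht _) (ihu f)
  | dotType => exact .dotType
  | @dotPi s₁ s₂ X X' Y Y' _ _ ihX ihY =>
    have := Par.dotPi s₁ s₂ (ihX f) (ihY f)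
    rw [← rename_succ_upr] at this
    exact this

theorem subst {t u : Tm CCConst} (h : Par t u) {σ τ : ℕ → Tm CCConst}
    (hσ : ∀ n, Par (σ n) (τ n)) : Par (t.subst σ) (u.subst τ) := by
  have up : ∀ {σ τ : ℕ → Tm CCConst}, (∀ n, Par (σ n) (τ n)) → ∀ n, Par (ups σ n) (ups τ n) :=
    fun h n => match n with
      | 0 => .var _
      | n + 1 => (h n).rename _
  induction h generalizing σ τ with
  | var n => exact hσ n
  | const c => exact .const c
  | sort s => exact .sort s
  | pi _ _ ihA ihB => exact .pi (ihA hσ) (ihB (up hσ))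
  | lam _ _ ihA iht => exact .lam (ihA hσ) (iht (up hσ))
  | app _ _ iht ihu => exact .app (iht hσ) (ihu hσ)
  | beta A _ _ iht ihu =>
    rw [inst_subst]
    exact .beta _ (iht (up hσ)) (ihu hσ)
  | dotType => exact .dotType
  | @dotPi s₁ s₂ X X' Y Y' _ _ ihX ihY =>
    have := Par.dotPi s₁ s₂ (ihX hσ) (ihY hσ)
    rw [← subst_rename_succ] at this
    exact this

theorem inst {t t' u u' : Tm CCConst} (ht : Par t t') (hu : Par u u') :
    Par (t.inst u) (t'.inst u') :=
  ht.subst fun n => match n with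
    | 0 => hu
    | _ + 1 => .var _

theorem dotPi_inv {s₁ s₂ : Srt} {X Y v : Tm CCConst}
    (h : Par (.app (.app (.const (.dotPi s₁ s₂)) X) Y) v) :
    ∃ X' Y', Par X X' ∧ Par Y Y' ∧ v = .app (.app (.const (.dotPi s₁ s₂)) X') Y' := by
  cases h with
  | app h hY =>
    cases h with
    | app h hX =>
      cases h
      exact ⟨_, _, hX, hY, rfl⟩

/-- Parallel reduction has the diamond property: the rules are left-linear, and no two left-hand sides
overlap. -/
theorem diamond {t u v : Tm CCConst} (hu : Par t u) (hv : Par t v) :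
    ∃ w, Par u w ∧ Par v w := by
  induction hu generalizing v with
  | var n => exact ⟨v, hv, refl v⟩
  | const c => exact ⟨v, hv, refl v⟩
  | sort s => exact ⟨v, hv, refl v⟩
  | pi _ _ ihA ihB =>
    cases hv with
    | pi hA hB =>
      obtain ⟨A, hA1, hA2⟩ := ihA hA
      obtain ⟨B, hB1, hB2⟩ := ihB hB
      exact ⟨_, .pi hA1 hB1, .pi hA2 hB2⟩
  | lam _ _ ihA ihB =>
    cases hv with
    | lam hA hB =>
      obtain ⟨A, hA1, hA2⟩ := ihA hA
      obtain ⟨B, hB1, hB2⟩ := ihB hB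
      exact ⟨_, .lam hA1 hB1, .lam hA2 hB2⟩
  | app ht hu iht ihu =>
    cases hv with
    | app ht' hu' =>
      obtain ⟨a, ha1, ha2⟩ := iht ht'
      obtain ⟨b, hb1, hb2⟩ := ihu hu'
      exact ⟨_, .app ha1 hb1, .app ha2 hb2⟩
    | beta A ht' hu' =>
      obtain ⟨b, hb1, hb2⟩ := ihu hu'
      obtain ⟨a, ha1, ha2⟩ := iht (.lam (refl A) ht')
      cases ht with
      | lam _ _ =>
        cases ha1 with
        | lam _ ha1 =>
          cases ha2 with
          | lam _ ha2 => exact ⟨_, .beta _ ha1 hb1, ha2.inst hb2⟩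
    | dotType =>
      cases ht; cases hu
      exact ⟨_, .dotType, .const _⟩
    | dotPi s₁ s₂ hX hY =>
      cases ht
      obtain ⟨w, hw1, hw2⟩ := ihu (.app (.app (.const _) hX) hY)
      obtain ⟨X1, Y1, -, -, rfl⟩ := dotPi_inv hu
      obtain ⟨X2, Y2, hX1, hY1, rfl⟩ := dotPi_inv hw1
      obtain ⟨X3, Y3, hX2, hY2, he⟩ := dotPi_inv hw2
      cases he
      exact ⟨_, .dotPi _ _ hX1 hY1,
        .pi (.app (.const _) hX2) (.app (.const _) (.app (hY2.rename _) (.var _)))⟩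
  | beta A _ _ iht ihu =>
    cases hv with
    | app ht' hu' =>
      obtain ⟨b, hb1, hb2⟩ := ihu hu'
      cases ht' with
      | lam _ ht' =>
        obtain ⟨a, ha1, ha2⟩ := iht ht'
        exact ⟨_, ha1.inst hb1, .beta _ ha2 hb2⟩
    | beta _ ht' hu' =>
      obtain ⟨a, ha1, ha2⟩ := iht ht'
      obtain ⟨b, hb1, hb2⟩ := ihu hu'
      exact ⟨_, ha1.inst hb1, ha2.inst hb2⟩
  | dotType =>
    cases hv with
    | app h1 h2 =>
      cases h1; cases h2
      exact ⟨_, .const _, .dotType⟩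
    | dotType => exact ⟨_, .const _, .const _⟩
  | dotPi s₁ s₂ _ _ ihX ihY =>
    cases hv with
    | app h1 h2 =>
      cases h1
      obtain ⟨X1, Y1, hX, hY, rfl⟩ := dotPi_inv h2
      obtain ⟨X2, hX1, hX2⟩ := ihX hX
      obtain ⟨Y2, hY1, hY2⟩ := ihY hY
      exact ⟨_, .pi (.app (.const _) hX1) (.app (.const _) (.app (hY1.rename _) (.var _))),
        .dotPi _ _ hX2 hY2⟩
    | dotPi _ _ hX hY =>
      obtain ⟨X2, hX1, hX2⟩ := ihX hX
      obtain ⟨Y2, hY1, hY2⟩ := ihY hY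
      exact ⟨_, .pi (.app (.const _) hX1) (.app (.const _) (.app (hY1.rename _) (.var _))),
        .pi (.app (.const _) hX2) (.app (.const _) (.app (hY2.rename _) (.var _)))⟩

end Par

theorem reds_iff_par {t u : Tm CCConst} : Reds t u ↔ ReflTransGen Par t u := by
  constructor
  · exact Relation.ReflTransGen.mono (fun _ _ => Par.of_red) _ _
  · intro h
    induction h with
    | refl => exact .refl
    | tail _ h ih => exact ih.trans h.reds

theorem Reds.confluent {t u v : Tm CCConst} (hu : Reds t u) (hv : Reds t v) :
    ∃ w, Reds u w ∧ Reds v w := by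
  obtain ⟨w, h1, h2⟩ := Relation.church_rosser
    (fun a b c (hb : Par a b) hc => (Par.diamond hb hc).imp fun _ h => ⟨.single h.1, .single h.2⟩)
    (reds_iff_par.1 hu) (reds_iff_par.1 hv)
  exact ⟨w, reds_iff_par.2 h1, reds_iff_par.2 h2⟩

/-- The Church–Rosser property. -/
theorem _root_.LambdaPi.Conv.join {t u : Tm CCConst} (h : Conv rules t u) :
    ∃ w, Reds t w ∧ Reds u w := by
  induction h with
  | rel t u h => exact ⟨u, .single h, .refl⟩
  | refl t => exact ⟨t, .refl, .refl⟩
  | symm t u _ ih => exact ih.imp fun _ h => h.symm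
  | trans t u v _ _ ih ih' =>
    obtain ⟨w, h1, h2⟩ := ih
    obtain ⟨w', h3, h4⟩ := ih'
    obtain ⟨x, h5, h6⟩ := h2.confluent h3
    exact ⟨x, h1.trans h5, h4.trans h6⟩

theorem Reds.pi_inv {A B t : Tm CCConst} (h : Reds (.pi A B) t) :
    ∃ A' B', t = .pi A' B' ∧ Reds A A' ∧ Reds B B' := by
  induction h with
  | refl => exact ⟨A, B, rfl, .refl, .refl⟩
  | tail _ h ih =>
    obtain ⟨A', B', rfl, hA, hB⟩ := ih
    cases h with
    | root h =>
      rcases h with h | h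
      · cases h
      · cases rewrite_iff.1 h
    | piLeft h => exact ⟨_, _, rfl, hA.tail h, hB⟩
    | piRight h => exact ⟨_, _, rfl, hA, hB.tail h⟩

/-- Injectivity of products. -/
theorem conv_pi_inj {A B A' B' : Tm CCConst} (h : Conv rules (.pi A B) (.pi A' B')) :
    Conv rules A A' ∧ Conv rules B B' := by
  obtain ⟨w, h1, h2⟩ := h.join
  obtain ⟨A1, B1, rfl, hA1, hB1⟩ := h1.pi_inv
  obtain ⟨A2, B2, he, hA2, hB2⟩ := h2.pi_inv
  cases he
  exact ⟨hA1.conv.trans hA2.conv.symm, hB1.conv.trans hB2.conv.symm⟩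

/-! ### Typing in the Calculus of constructions -/

/-- The type of a constant. -/
def constType : CCConst → Tm CCConst
  | .U _ => sort .type
  | .dotType => U .kind
  | .eps s => arrow (U s) (sort .type)
  | .dotPi s₁ s₂ => dotPiType s₁ s₂

theorem eq_constType {c : CCConst} {A : Tm CCConst} (h : (c, A) ∈ sig) : A = constType c := by
  simp only [sig, baseSig, List.mem_cons, Prod.mk.injEq, List.not_mem_nil, or_false] at h
  rcases h with h | h | h | h | h | h | h | h | h <;> obtain ⟨rfl, rfl⟩ := h <;> rfl

theorem constType_rename (c : CCConst) (f : ℕ → ℕ) : (constType c).rename f = constType c := by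
  cases c <;> rfl

theorem constType_subst (c : CCConst) (σ : ℕ → Tm CCConst) :
    (constType c).subst σ = constType c := by
  cases c <;> rfl

/-- The variable `n` has type `T` in the context `Γ`; unlike the entries of `Γ`, the type `T` lives
in the whole context `Γ`. -/
inductive Lookup : Ctx CCConst → ℕ → Tm CCConst → Prop
  | zero {Γ : Ctx CCConst} {A : Tm CCConst} : Lookup (A :: Γ) 0 (A.rename Nat.succ)
  | succ {Γ : Ctx CCConst} {A T : Tm CCConst} {n : ℕ} :
      Lookup Γ n T → Lookup (A :: Γ) (n + 1) (T.rename Nat.succ)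

theorem Lookup.of_getElem? {Γ : Ctx CCConst} {n : ℕ} {A : Tm CCConst} (h : Γ[n]? = some A) :
    Lookup Γ n (A.rename (· + (n + 1))) := by
  induction Γ generalizing n with
  | nil => simp at h
  | cons B Γ ih =>
    cases n with
    | zero =>
      simp only [List.getElem?_cons_zero, Option.some.injEq] at h
      subst h
      exact .zero
    | succ n =>
      have := Lookup.succ (A := B) (ih (n := n) (by simpa using h))
      rwa [rename_rename] at this

/-- Typing without well-formedness of contexts: the judgement `Γ ⊢ t : A` is meaningful when the
types in `Γ` have type `Type`, see `CtxOk`. In the conversion rule the two types may have different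
sorts. -/
inductive Typ : Ctx CCConst → Tm CCConst → Tm CCConst → Prop
  | sort {Γ : Ctx CCConst} : Typ Γ (sort .type) (sort .kind)
  | var {Γ : Ctx CCConst} {n : ℕ} {T : Tm CCConst} : Lookup Γ n T → Typ Γ (var n) T
  | const {Γ : Ctx CCConst} (c : CCConst) : Typ Γ (const c) (constType c)
  | pi {Γ : Ctx CCConst} {A B : Tm CCConst} {s : Srt} :
      Typ Γ A (sort .type) → Typ (A :: Γ) B (sort s) → Typ Γ (pi A B) (sort s)
  | lam {Γ : Ctx CCConst} {A B t : Tm CCConst} {s : Srt} : Typ Γ A (sort .type) →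
      Typ (A :: Γ) B (sort s) → Typ (A :: Γ) t B → Typ Γ (lam A t) (pi A B)
  | app {Γ : Ctx CCConst} {A B t u : Tm CCConst} :
      Typ Γ t (pi A B) → Typ Γ u A → Typ Γ (app t u) (B.inst u)
  | conv {Γ : Ctx CCConst} {A B t : Tm CCConst} {s s' : Srt} : Typ Γ A (sort s) →
      Typ Γ B (sort s') → Typ Γ t A → Conv rules A B → Typ Γ t B

/-- Contexts declaring objects only: each type has type `Type`. -/
inductive CtxOk : Ctx CCConst → Prop
  | nil : CtxOk []
  | cons {Γ : Ctx CCConst} {A : Tm CCConst} : CtxOk Γ → Typ Γ A (sort .type) → CtxOk (A :: Γ)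

theorem Typ.of_hasType {Γ : Ctx CCConst} {t A : Tm CCConst} (h : HasType sig rules Γ t A) :
    Typ Γ t A := by
  refine HasType.rec (motive_1 := fun _ _ => True) (motive_2 := fun Γ t A _ => Typ Γ t A)
    trivial ?_ ?_ ?_ ?_ ?_ ?_ ?_ ?_ h
  · intros; trivial
  · intros; exact .sort
  · intro _ _ _ _ h _
    exact .var (.of_getElem? h)
  · intro _ c A _ h _
    rw [eq_constType h]
    exact .const c
  · intro _ _ _ _ _ _ ihA ihB
    exact .pi ihA ihB
  · intro _ _ _ _ _ _ _ _ ihA ihB iht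
    exact .lam ihA ihB iht
  · intro _ _ _ _ _ _ _ iht ihu
    exact .app iht ihu
  · intro _ _ _ _ _ _ _ _ h ihA ihB iht
    exact .conv ihA ihB iht h

theorem Typ.rename {Γ Δ : Ctx CCConst} {t A : Tm CCConst} (h : Typ Γ t A) {f : ℕ → ℕ}
    (hf : ∀ n T, Lookup Γ n T → Lookup Δ (f n) (T.rename f)) :
    Typ Δ (t.rename f) (A.rename f) := by
  have up : ∀ {Γ Δ : Ctx CCConst} {f : ℕ → ℕ} (A : Tm CCConst),
      (∀ n T, Lookup Γ n T → Lookup Δ (f n) (T.rename f)) →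
      ∀ n T, Lookup (A :: Γ) n T → Lookup (A.rename f :: Δ) (upr f n) (T.rename (upr f)) := by
    rintro Γ Δ f A h _ _ (_ | h')
    · rw [rename_succ_upr]
      exact .zero
    · rw [rename_succ_upr]
      exact .succ (h _ _ h')
  induction h generalizing Δ f with
  | sort => exact .sort
  | var h => exact .var (hf _ _ h)
  | const c => rw [constType_rename]; exact .const c
  | pi _ _ ihA ihB => exact .pi (ihA hf) (ihB (up _ hf))
  | lam _ _ _ ihA ihB iht => exact .lam (ihA hf) (ihB (up _ hf)) (iht (up _ hf))
  | app _ _ iht ihu =>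
    rw [inst_rename]
    exact .app (iht hf) (ihu hf)
  | conv _ _ _ h ihA ihB iht => exact .conv (ihA hf) (ihB hf) (iht hf) (h.rename f)

theorem Typ.weaken {Γ : Ctx CCConst} {t A : Tm CCConst} (h : Typ Γ t A) (B : Tm CCConst) :
    Typ (B :: Γ) (t.rename Nat.succ) (A.rename Nat.succ) :=
  h.rename fun _ _ h => .succ h

theorem Typ.subst {Γ Δ : Ctx CCConst} {t A : Tm CCConst} (h : Typ Γ t A) {σ : ℕ → Tm CCConst}
    (hσ : ∀ n T, Lookup Γ n T → Typ Δ (σ n) (T.subst σ)) : Typ Δ (t.subst σ) (A.subst σ) := by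
  have up : ∀ {Γ Δ : Ctx CCConst} {σ : ℕ → Tm CCConst} (A : Tm CCConst),
      (∀ n T, Lookup Γ n T → Typ Δ (σ n) (T.subst σ)) →
      ∀ n T, Lookup (A :: Γ) n T → Typ (A.subst σ :: Δ) (ups σ n) (T.subst (ups σ)) := by
    rintro Γ Δ σ A h _ _ (_ | h')
    · rw [subst_rename_succ]
      exact .var .zero
    · rw [subst_rename_succ]
      exact (h _ _ h').weaken _
  induction h generalizing Δ σ with
  | sort => exact .sort
  | var h => exact hσ _ _ h
  | const c => rw [constType_subst]; exact .const c
  | pi _ _ ihA ihB => exact .pi (ihA hσ) (ihB (up _ hσ))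
  | lam _ _ _ ihA ihB iht => exact .lam (ihA hσ) (ihB (up _ hσ)) (iht (up _ hσ))
  | app _ _ iht ihu =>
    rw [inst_subst]
    exact .app (iht hσ) (ihu hσ)
  | conv _ _ _ h ihA ihB iht => exact .conv (ihA hσ) (ihB hσ) (iht hσ) (h.subst σ)

theorem Typ.inst {Γ : Ctx CCConst} {A t B u : Tm CCConst} (h : Typ (A :: Γ) t B)
    (hu : Typ Γ u A) : Typ Γ (t.inst u) (B.inst u) := by
  refine h.subst ?_
  rintro _ _ (_ | h')
  · exact ((rename_succ_inst A u).symm ▸ hu : Typ Γ u ((A.rename Nat.succ).inst u))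
  · rename_i T n
    exact ((rename_succ_inst T u).symm ▸ .var h' : Typ Γ (.var n) ((T.rename Nat.succ).inst u))

/-- Replacing the last type of a context by a convertible one. -/
theorem Typ.conv_ctx {Γ : Ctx CCConst} {A A' t B : Tm CCConst} (h : Typ (A :: Γ) t B)
    (hA : Typ Γ A (.sort .type)) (hA' : Typ Γ A' (.sort .type)) (hc : Conv rules A A') :
    Typ (A' :: Γ) t B := by
  have := h.subst (Δ := A' :: Γ) (σ := Tm.var) ?_
  · rwa [subst_var, subst_var] at this
  · rintro _ _ (_ | h')
    · rw [subst_var]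
      exact .conv (hA'.weaken _) (hA.weaken _) (.var .zero) (hc.symm.rename _)
    · rw [subst_var]
      exact .var (.succ h')

theorem Typ.U {Γ : Ctx CCConst} (s : Srt) : Typ Γ (U s) (.sort .type) := .const (.U s)

theorem Typ.eps {Γ : Ctx CCConst} {s : Srt} {t : Tm CCConst} (h : Typ Γ t (CC.U s)) :
    Typ Γ (eps s t) (.sort .type) := Typ.app (.const (.eps s)) h

theorem Typ.arrow {Γ : Ctx CCConst} {A B : Tm CCConst} {s : Srt} (hA : Typ Γ A (.sort .type))
    (hB : Typ Γ B (.sort s)) : Typ Γ (arrow A B) (.sort s) := .pi hA (hB.weaken A)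

theorem Typ.dotPi {Γ : Ctx CCConst} {s₁ s₂ : Srt} {X Y : Tm CCConst} (hX : Typ Γ X (CC.U s₁))
    (hY : Typ Γ Y (Tm.arrow (CC.eps s₁ X) (CC.U s₂))) : Typ Γ (dotPi s₁ s₂ X Y) (CC.U s₂) :=
  Typ.app (A := Tm.arrow (CC.eps s₁ X) (CC.U s₂)) (B := CC.U s₂)
    (.app (B := Tm.arrow (Tm.arrow (CC.eps s₁ (.var 0)) (CC.U s₂)) (CC.U s₂))
      (.const (.dotPi s₁ s₂)) hX) hY

/-- The right-hand side of the rule for products is a type. -/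
theorem Typ.dotPi_rhs {Γ : Ctx CCConst} {s₁ s₂ : Srt} {X Y : Tm CCConst}
    (hX : Typ Γ X (CC.U s₁)) (hY : Typ Γ Y (Tm.arrow (CC.eps s₁ X) (CC.U s₂))) :
    Typ Γ (.pi (CC.eps s₁ X) (CC.eps s₂ (.app (Y.rename Nat.succ) (.var 0)))) (.sort .type) :=
  .pi hX.eps (Typ.eps (Typ.app (B := CC.U s₂) (hY.weaken _) (.var .zero)))

theorem Typ.constType {Γ : Ctx CCConst} (c : CCConst) : ∃ s, Typ Γ (constType c) (.sort s) := by
  cases c with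
  | U s => exact ⟨_, .sort⟩
  | dotType => exact ⟨_, .U _⟩
  | eps s => exact ⟨_, .arrow (.U _) .sort⟩
  | dotPi s₁ s₂ =>
    exact ⟨.type, .pi (.U _) (.arrow (.arrow (Typ.eps (.var .zero)) (.U _)) (.U _))⟩

theorem CtxOk.lookup {Γ : Ctx CCConst} (h : CtxOk Γ) {n : ℕ} {T : Tm CCConst}
    (hl : Lookup Γ n T) : Typ Γ T (.sort .type) := by
  induction hl with
  | zero => cases h with | cons _ hA => exact hA.weaken _
  | succ _ ih => cases h with | cons h _ => exact (ih h).weaken _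

theorem Typ.pi_inv {Γ : Ctx CCConst} {A B T : Tm CCConst} (h : Typ Γ (.pi A B) T) :
    Typ Γ A (.sort .type) ∧ ∃ s, Typ (A :: Γ) B (.sort s) := by
  generalize ht : Tm.pi A B = t at h
  induction h with
  | pi hA hB => cases ht; exact ⟨hA, _, hB⟩
  | conv _ _ _ _ _ _ ih => exact ih ht
  | _ => cases ht

theorem Typ.lam_inv {Γ : Ctx CCConst} {A t T : Tm CCConst} (h : Typ Γ (.lam A t) T) :
    ∃ B s, Typ Γ A (.sort .type) ∧ Typ (A :: Γ) B (.sort s) ∧ Typ (A :: Γ) t B ∧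
      Conv rules (.pi A B) T := by
  generalize ht : Tm.lam A t = t' at h
  induction h with
  | lam hA hB h => cases ht; exact ⟨_, _, hA, hB, h, .refl _⟩
  | conv _ _ _ hc _ _ ih =>
    obtain ⟨B, s, hA, hB, h, hc'⟩ := ih ht
    exact ⟨B, s, hA, hB, h, hc'.trans hc⟩
  | _ => cases ht

theorem Typ.app_inv {Γ : Ctx CCConst} {t u T : Tm CCConst} (h : Typ Γ (.app t u) T) :
    ∃ A B, Typ Γ t (.pi A B) ∧ Typ Γ u A ∧ Conv rules (B.inst u) T := by
  generalize ht : Tm.app t u = t' at h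
  induction h with
  | app h hu => cases ht; exact ⟨_, _, h, hu, .refl _⟩
  | conv _ _ _ hc _ _ ih =>
    obtain ⟨A, B, h, hu, hc'⟩ := ih ht
    exact ⟨A, B, h, hu, hc'.trans hc⟩
  | _ => cases ht

theorem Typ.const_inv {Γ : Ctx CCConst} {c : CCConst} {T : Tm CCConst} (h : Typ Γ (.const c) T) :
    Conv rules (CC.constType c) T := by
  generalize ht : Tm.const c = t' at h
  induction h with
  | const c => cases ht; exact .refl _
  | conv _ _ _ hc _ _ ih => exact (ih ht).trans hc
  | _ => cases ht

/-- The type of a term is itself typed by a sort, except for `Kind`. -/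
theorem Typ.isType {Γ : Ctx CCConst} {t A : Tm CCConst} (h : Typ Γ t A) (hΓ : CtxOk Γ) :
    A = .sort .kind ∨ ∃ s, Typ Γ A (.sort s) := by
  induction h with
  | sort => exact .inl rfl
  | var h => exact .inr ⟨_, hΓ.lookup h⟩
  | const c => exact .inr (Typ.constType c)
  | @pi _ _ _ s => cases s with
    | type => exact .inr ⟨_, .sort⟩
    | kind => exact .inl rfl
  | lam hA hB => exact .inr ⟨_, .pi hA hB⟩
  | app _ hu iht =>
    rcases iht hΓ with h | ⟨s, h⟩
    · cases h
    · obtain ⟨_, s, hB⟩ := h.pi_inv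
      exact .inr ⟨s, hB.inst hu⟩
  | conv _ hB => exact .inr ⟨_, hB⟩

theorem Typ.pi_isType {Γ : Ctx CCConst} {t A B : Tm CCConst} (h : Typ Γ t (.pi A B))
    (hΓ : CtxOk Γ) : Typ Γ A (.sort .type) ∧ ∃ s, Typ (A :: Γ) B (.sort s) := by
  rcases h.isType hΓ with h | ⟨s, h⟩
  · cases h
  · exact h.pi_inv

/-- The argument of a typed redex has the type declared by the abstraction. -/
theorem Typ.beta_inv {Γ : Ctx CCConst} {A B C t u : Tm CCConst} (hΓ : CtxOk Γ)
    (h : Typ Γ (.lam C t) (.pi A B)) (hu : Typ Γ u A) :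
    ∃ B' s, Typ Γ C (.sort .type) ∧ Typ Γ u C ∧ Typ (C :: Γ) B' (.sort s) ∧ Typ (C :: Γ) t B' ∧
      Conv rules B' B := by
  obtain ⟨B', s, hC, hB', ht, hc⟩ := h.lam_inv
  obtain ⟨hc1, hc2⟩ := conv_pi_inj hc
  exact ⟨B', s, hC, .conv (h.pi_isType hΓ).1 hC hu hc1.symm, hB', ht, hc2⟩

theorem Typ.eps_inv {Γ : Ctx CCConst} {s : Srt} {A B t : Tm CCConst} (hΓ : CtxOk Γ)
    (h : Typ Γ (.const (.eps s)) (.pi A B)) (ht : Typ Γ t A) :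
    Typ Γ t (CC.U s) ∧ Conv rules (.sort .type) (B.inst t) := by
  obtain ⟨hc1, hc2⟩ := conv_pi_inj h.const_inv
  exact ⟨.conv (h.pi_isType hΓ).1 (.U s) ht hc1.symm, hc2.inst_left t⟩

theorem Typ.dotPi_inv {Γ : Ctx CCConst} {s₁ s₂ : Srt} {X Y T : Tm CCConst} (hΓ : CtxOk Γ)
    (h : Typ Γ (CC.dotPi s₁ s₂ X Y) T) :
    Typ Γ X (CC.U s₁) ∧ Typ Γ Y (Tm.arrow (CC.eps s₁ X) (CC.U s₂)) := by
  obtain ⟨A, B, h, hY, -⟩ := h.app_inv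
  obtain ⟨A', B', h', hX, hc⟩ := h.app_inv
  obtain ⟨hc1, hc2⟩ := conv_pi_inj h'.const_inv
  have hX' : Typ Γ X (CC.U s₁) := .conv (h'.pi_isType hΓ).1 (.U _) hX hc1.symm
  have hc3 := (conv_pi_inj ((hc2.inst_left X).trans hc)).1
  exact ⟨hX', .conv (h.pi_isType hΓ).1 (.arrow hX'.eps (.U s₂)) hY hc3.symm⟩

/-- Subject reduction. -/
theorem Typ.red {Γ : Ctx CCConst} {t t' A : Tm CCConst} (h : Typ Γ t A) (hΓ : CtxOk Γ)
    (hr : Red t t') : Typ Γ t' A := by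
  -- A root redex is an application.
  have nr : ∀ {t t' : Tm CCConst}, BetaRewrite rules t t' → ∃ a b, t = .app a b := by
    rintro _ _ (⟨_, _, _⟩ | h)
    · exact ⟨_, _, rfl⟩
    · rcases rewrite_iff.1 h with _ | _ <;> exact ⟨_, _, rfl⟩
  induction h generalizing t' with
  | sort | var | const =>
    cases hr with
    | root h => obtain ⟨_, _, h⟩ := nr h; cases h
  | pi hA hB ihA ihB =>
    cases hr with
    | root h => obtain ⟨_, _, h⟩ := nr h; cases h
    | piLeft h => exact .pi (ihA hΓ h) (hB.conv_ctx hA (ihA hΓ h) (.step h))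
    | piRight h => exact .pi hA (ihB (hΓ.cons hA) h)
  | lam hA hB ht ihA ihB iht =>
    cases hr with
    | root h => obtain ⟨_, _, h⟩ := nr h; cases h
    | lamLeft h =>
      have hA' := ihA hΓ h
      have hc := Conv.step h
      have hB' := hB.conv_ctx hA hA' hc
      exact .conv (.pi hA' hB') (.pi hA hB) (.lam hA' hB' (ht.conv_ctx hA hA' hc))
        (.pi hc.symm (.refl _))
    | lamRight h => exact .lam hA hB (iht (hΓ.cons hA) h)
  | @app Γ A B t u ht hu iht ihu =>
    obtain ⟨hA, s, hB⟩ := ht.pi_isType hΓ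
    cases hr with
    | root h =>
      rcases h with ⟨C, t, u⟩ | h
      · obtain ⟨B', _, -, hu', hB', ht', hc⟩ := ht.beta_inv hΓ hu
        exact .conv (hB'.inst hu') (hB.inst hu) (ht'.inst hu') (hc.inst_left _)
      · obtain h | ⟨s₁, s₂, X, Y⟩ := rewrite_iff.1 h
        · exact .conv .sort (hB.inst hu) (.U .type) (ht.eps_inv hΓ hu).2
        · obtain ⟨h1, h2⟩ := ht.eps_inv hΓ hu
          obtain ⟨hX, hY⟩ := h1.dotPi_inv hΓ
          exact .conv .sort (hB.inst hu) (hX.dotPi_rhs hY) h2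
    | appLeft h => exact .app (iht hΓ h) hu
    | appRight h =>
      have hu' := ihu hΓ h
      exact .conv (hB.inst hu') (hB.inst hu) (.app ht hu') (.inst_right _ (Conv.step h).symm)
  | conv hA hB _ hc _ _ ih => exact .conv hA hB (ih hΓ hr) hc

theorem Typ.reds {Γ : Ctx CCConst} {t t' A : Tm CCConst} (h : Typ Γ t A) (hΓ : CtxOk Γ)
    (hr : Reds t t') : Typ Γ t' A := by
  induction hr with
  | refl => exact h
  | tail _ hr ih => exact ih.red hΓ hr

/-- A map that is invariant under the reduction steps of the typed terms of a context is invariant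
under the conversion of its typed terms. -/
theorem Typ.conv_induction {Γ : Ctx CCConst} (hΓ : CtxOk Γ) {α : Type*} {f : Tm CCConst → α}
    (hf : ∀ t t' A, Typ Γ t A → Red t t' → f t = f t') {t u A B : Tm CCConst} (ht : Typ Γ t A)
    (hu : Typ Γ u B) (hc : Conv rules t u) : f t = f u := by
  have key : ∀ {t u A}, Typ Γ t A → Reds t u → f t = f u := by
    intro t u A ht hr
    induction hr with
    | refl => rfl
    | tail hr h ih => exact ih.trans (hf _ _ _ (ht.reds hΓ hr) h)
  obtain ⟨w, h1, h2⟩ := hc.join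
  exact (key ht h1).trans (key hu h2).symm

end CC

/-! ### Functions and products of sets -/

namespace ZF

/-- The set-theoretic function `x ∈ A ↦ f x` in Aczel's encoding, that is the set of the pairs
`(x, y)` with `x ∈ A` and `y ∈ f x`. The function with constant value `∅` is `∅`, on any domain. -/
noncomputable def lam (A : ZFSet.{0}) (f : ZFSet.{0} → ZFSet.{0}) : ZFSet.{0} :=
  ZFSet.range fun p : Σ x : {x // x ∈ A}, {y // y ∈ f x} => ZFSet.pair p.1 p.2

/-- Application of a set-theoretic function in Aczel's encoding. -/
noncomputable def app (g x : ZFSet.{0}) : ZFSet.{0} :=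
  ZFSet.sep (fun y => ZFSet.pair x y ∈ g) (ZFSet.sUnion (ZFSet.sUnion g))

theorem mem_lam {A : ZFSet} {f : ZFSet → ZFSet} {p : ZFSet} :
    p ∈ lam A f ↔ ∃ x ∈ A, ∃ y ∈ f x, ZFSet.pair x y = p := by
  simp [lam]

theorem mem_app {g x y : ZFSet} : y ∈ app g x ↔ ZFSet.pair x y ∈ g := by
  rw [app, ZFSet.mem_sep, and_iff_right_iff_imp]
  intro h
  refine ZFSet.mem_sUnion_of_mem (z := {x, y}) (by simp) (ZFSet.mem_sUnion_of_mem ?_ h)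
  simp [ZFSet.pair]

theorem app_lam {A x : ZFSet} (f : ZFSet → ZFSet) (hx : x ∈ A) : app (lam A f) x = f x := by
  ext y
  rw [mem_app, mem_lam]
  constructor
  · rintro ⟨x', -, y', hy, h⟩
    obtain ⟨rfl, rfl⟩ := ZFSet.pair_inj.1 h
    exact hy
  · exact fun hy => ⟨x, hx, y, hy, rfl⟩

theorem lam_congr {A : ZFSet} {f g : ZFSet → ZFSet} (h : ∀ x ∈ A, f x = g x) :
    lam A f = lam A g := by
  ext p
  simp only [mem_lam]
  constructor <;> rintro ⟨x, hx, y, hy, rfl⟩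
  · exact ⟨x, hx, y, h x hx ▸ hy, rfl⟩
  · exact ⟨x, hx, y, (h x hx).symm ▸ hy, rfl⟩

theorem lam_empty (A : ZFSet) : lam A (fun _ => ∅) = ∅ := by
  ext p
  simp [mem_lam]

/-- The set of the functions that map every `x ∈ A` to an element of `B x`. -/
noncomputable def pi (A : ZFSet.{0}) (B : ZFSet.{0} → ZFSet.{0}) : ZFSet.{0} :=
  ZFSet.sep (fun g => ∃ f, (∀ x ∈ A, f x ∈ B x) ∧ lam A f = g)
    (ZFSet.powerset (lam A fun x => ZFSet.sUnion (B x)))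

theorem mem_pi {A g : ZFSet} {B : ZFSet → ZFSet} :
    g ∈ pi A B ↔ ∃ f, (∀ x ∈ A, f x ∈ B x) ∧ lam A f = g := by
  rw [pi, ZFSet.mem_sep, and_iff_right_iff_imp, ZFSet.mem_powerset]
  rintro ⟨f, hf, rfl⟩ p hp
  obtain ⟨x, hx, y, hy, rfl⟩ := mem_lam.1 hp
  exact mem_lam.2 ⟨x, hx, y, ZFSet.mem_sUnion_of_mem hy (hf x hx), rfl⟩

theorem lam_mem_pi {A : ZFSet} {f B : ZFSet → ZFSet} (h : ∀ x ∈ A, f x ∈ B x) :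
    lam A f ∈ pi A B := mem_pi.2 ⟨f, h, rfl⟩

theorem app_mem {A g x : ZFSet} {B : ZFSet → ZFSet} (hg : g ∈ pi A B) (hx : x ∈ A) :
    app g x ∈ B x := by
  obtain ⟨f, hf, rfl⟩ := mem_pi.1 hg
  rw [app_lam f hx]
  exact hf x hx

theorem pi_congr {A : ZFSet} {B B' : ZFSet → ZFSet} (h : ∀ x ∈ A, B x = B' x) :
    pi A B = pi A B' := by
  ext g
  simp only [mem_pi]
  refine exists_congr fun f => and_congr_left fun _ => forall₂_congr fun x hx => ?_
  rw [h x hx]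

/-- The set `{∅}`, in the role of a type whose elements carry no information. -/
noncomputable def unit : ZFSet.{0} := {∅}

theorem mem_unit {x : ZFSet} : x ∈ unit ↔ x = ∅ := ZFSet.mem_singleton

/-- A product of types without information has no information. This is what Aczel's encoding is
used for. -/
theorem pi_unit (A : ZFSet) : pi A (fun _ => unit) = unit := by
  ext g
  rw [mem_pi, mem_unit]
  constructor
  · rintro ⟨f, hf, rfl⟩
    rw [lam_congr fun x hx => mem_unit.1 (hf x hx), lam_empty]
  · rintro rfl
    exact ⟨fun _ => ∅, fun _ _ => mem_unit.2 rfl, lam_empty A⟩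

attribute [irreducible] lam app pi

/-- The truth value `true`; the truth value `false` is `∅`. -/
noncomputable def true : ZFSet.{0} := {∅}

/-- The set of truth values. -/
noncomputable def two : ZFSet.{0} := {∅, true}

open Classical in
/-- The truth value of a proposition. -/
noncomputable def truth (p : Prop) : ZFSet.{0} := if p then true else ∅

theorem true_ne_empty : true ≠ ∅ := fun h => by
  have : (∅ : ZFSet) ∈ true := by simp [true]
  rw [h] at this
  exact ZFSet.notMem_empty _ this

theorem truth_eq_true {p : Prop} : truth p = true ↔ p := by
  unfold truth
  split <;> simp_all [true_ne_empty.symm]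

theorem true_mem_two : true ∈ two := by simp [two]

theorem empty_mem_two : ∅ ∈ two := by simp [two]

theorem truth_mem_two (p : Prop) : truth p ∈ two := by
  unfold truth
  split
  · exact true_mem_two
  · exact empty_mem_two

end ZF

namespace CC

open ZF (unit two truth)

/-! ### Levels and shapes -/

/-- The stratification of terms: `0` for objects, `1` for types and families of types, `2` for the
kinds, and `3` for `Kind`. Variables are objects. -/
def level : Tm CCConst → ℕ
  | var _ => 0
  | const (.U _) => 1
  | const .dotType => 0
  | const (.eps _) => 1
  | const (.dotPi _ _) => 0
  | sort .type => 2
  | sort .kind => 3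
  | pi _ B => level B
  | lam _ t => level t
  | app t _ => level t

/-- Binders bind objects, and arguments are objects. Unlike typing, this discipline is obviously
closed under reduction. -/
def Stratified : Tm CCConst → Prop
  | var _ => True
  | const _ => True
  | sort _ => True
  | pi A B => Stratified A ∧ level A = 1 ∧ Stratified B
  | lam A t => Stratified A ∧ level A = 1 ∧ Stratified t
  | app t u => Stratified t ∧ Stratified u ∧ level u = 0

/-- Codes for the sets that interpret the elements of `U_Kind`. -/
inductive KindCode where
  | unit
  | prop
  | arrow (a b : KindCode)

/-- The set denoted by a code. The product over `unit` is there because products have two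
arguments, an element of the shape of the domain and an element of the carrier of the domain. -/
noncomputable def KindCode.decode : KindCode → ZFSet.{0}
  | unit => ZF.unit
  | prop => two
  | arrow a b => ZF.pi ZF.unit fun _ => ZF.pi a.decode fun _ => b.decode

/-- The set of the sets that interpret the elements of `U_Kind`. -/
noncomputable def kinds : ZFSet.{0} := ZFSet.range KindCode.decode

theorem unit_mem_kinds : unit ∈ kinds := ZFSet.mem_range.2 ⟨.unit, rfl⟩

theorem two_mem_kinds : two ∈ kinds := ZFSet.mem_range.2 ⟨.prop, rfl⟩

theorem arrow_mem_kinds {a b : ZFSet} (ha : a ∈ kinds) (hb : b ∈ kinds) :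
    ZF.pi unit (fun _ => ZF.pi a fun _ => b) ∈ kinds := by
  obtain ⟨a, rfl⟩ := ZFSet.mem_range.1 ha
  obtain ⟨b, rfl⟩ := ZFSet.mem_range.1 hb
  exact ZFSet.mem_range.2 ⟨.arrow a b, rfl⟩

/-- The first layer of the model. The shape of a type is the set of the carriers that an element of
this type may have: the carrier of an element of `U_Kind` is any set in `kinds`, and the elements of
`U_Type`, `ε_Type X` and `ε_Kind X` have no carrier to speak of. On other terms, the value is
chosen so as to be invariant under reduction. -/
noncomputable def shape : Tm CCConst → ZFSet.{0}
  | var _ => unit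
  | const (.U .kind) => kinds
  | const _ => unit
  | sort _ => unit
  | pi A B => ZF.pi (shape A) fun _ => shape B
  | lam _ t => shape t
  | app t _ => shape t

theorem level_rename (t : Tm CCConst) (f : ℕ → ℕ) : level (t.rename f) = level t := by
  induction t generalizing f with
  | var n => rfl
  | const c => rfl
  | sort s => rfl
  | pi A B _ ih => exact ih _
  | lam A t _ ih => exact ih _
  | app t u ih _ => exact ih _

theorem level_ups {σ : ℕ → Tm CCConst} (hσ : ∀ n, level (σ n) = 0) (n : ℕ) :
    level (ups σ n) = 0 := by
  cases n with
  | zero => rfl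
  | succ n => exact (level_rename _ _).trans (hσ n)

theorem level_subst (t : Tm CCConst) {σ : ℕ → Tm CCConst} (hσ : ∀ n, level (σ n) = 0) :
    level (t.subst σ) = level t := by
  induction t generalizing σ with
  | var n => exact hσ n
  | const c => rfl
  | sort s => rfl
  | pi A B _ ih => exact ih (level_ups hσ)
  | lam A t _ ih => exact ih (level_ups hσ)
  | app t u ih _ => exact ih hσ

theorem level_single {u : Tm CCConst} (hu : level u = 0) (n : ℕ) : level (single u n) = 0 := by
  cases n with
  | zero => exact hu
  | succ n => rfl

theorem level_inst (t : Tm CCConst) {u : Tm CCConst} (hu : level u = 0) :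
    level (t.inst u) = level t := level_subst t (level_single hu)

theorem shape_eq_unit {t : Tm CCConst} (h : level t = 0) : shape t = unit := by
  induction t with
  | var n => rfl
  | const c =>
    cases c with
    | U s => cases h
    | _ => rfl
  | sort s => rfl
  | pi A B _ ih =>
    rw [shape, ih h]
    exact ZF.pi_unit _
  | lam A t _ ih => exact ih h
  | app t u ih _ => exact ih h

theorem shape_rename (t : Tm CCConst) (f : ℕ → ℕ) : shape (t.rename f) = shape t := by
  induction t generalizing f <;> simp_all [rename, shape]

theorem shape_subst (t : Tm CCConst) {σ : ℕ → Tm CCConst} (hσ : ∀ n, level (σ n) = 0) :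
    shape (t.subst σ) = shape t := by
  induction t generalizing σ with
  | var n => exact shape_eq_unit (hσ n)
  | const c => rfl
  | sort s => rfl
  | pi A B ihA ih => simp only [subst, shape, ihA hσ, ih (level_ups hσ)]
  | lam A t _ ih => exact ih (level_ups hσ)
  | app t u ih _ => exact ih hσ

theorem shape_inst (t : Tm CCConst) {u : Tm CCConst} (hu : level u = 0) :
    shape (t.inst u) = shape t := shape_subst t (level_single hu)

namespace Stratified

theorem rename {t : Tm CCConst} (h : Stratified t) (f : ℕ → ℕ) : Stratified (t.rename f) := by
  induction t generalizing f <;> simp_all [Tm.rename, Stratified, level_rename]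

theorem ups {σ : ℕ → Tm CCConst} (hσ : ∀ n, Stratified (σ n)) (n : ℕ) :
    Stratified (ups σ n) := by
  cases n with
  | zero => trivial
  | succ n => exact (hσ n).rename _

theorem subst {t : Tm CCConst} (h : Stratified t) {σ : ℕ → Tm CCConst}
    (hσ : ∀ n, Stratified (σ n)) (hl : ∀ n, level (σ n) = 0) : Stratified (t.subst σ) := by
  induction t generalizing σ with
  | var n => exact hσ n
  | const c => trivial
  | sort s => trivial
  | pi A B ihA ih =>
    exact ⟨ihA h.1 hσ hl, (level_subst A hl).trans h.2.1, ih h.2.2 (ups hσ) (level_ups hl)⟩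
  | lam A t ihA ih =>
    exact ⟨ihA h.1 hσ hl, (level_subst A hl).trans h.2.1, ih h.2.2 (ups hσ) (level_ups hl)⟩
  | app t u iht ihu => exact ⟨iht h.1 hσ hl, ihu h.2.1 hσ hl, (level_subst u hl).trans h.2.2⟩

theorem inst {t u : Tm CCConst} (h : Stratified t) (hu : Stratified u) (hl : level u = 0) :
    Stratified (t.inst u) := by
  refine h.subst (fun n => ?_) (level_single hl)
  cases n with
  | zero => exact hu
  | succ n => trivial

theorem red {t t' : Tm CCConst} (h : Stratified t) (hr : Red t t') :
    Stratified t' ∧ level t' = level t ∧ shape t' = shape t := by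
  induction hr with
  | root hr =>
    rcases hr with ⟨A, t, u⟩ | hr
    · exact ⟨h.1.2.2.inst h.2.1 h.2.2, level_inst t h.2.2, shape_inst t h.2.2⟩
    · rcases rewrite_iff.1 hr with _ | ⟨s₁, s₂, X, Y⟩
      · exact ⟨trivial, rfl, rfl⟩
      · obtain ⟨-, ⟨⟨-, hX⟩, hY⟩, -⟩ := h
        refine ⟨⟨⟨trivial, hX⟩, rfl, trivial, ⟨hY.1.rename _, trivial, rfl⟩, ?_⟩, rfl, ?_⟩
        · exact (level_rename Y _).trans hY.2
        · exact ZF.pi_unit _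
  | piLeft _ ih =>
    obtain ⟨h1, h2, h3⟩ := ih h.1
    exact ⟨⟨h1, h2.trans h.2.1, h.2.2⟩, rfl, by simp only [shape, h3]⟩
  | piRight _ ih =>
    obtain ⟨h1, h2, h3⟩ := ih h.2.2
    exact ⟨⟨h.1, h.2.1, h1⟩, h2, by simp only [shape, h3]⟩
  | lamLeft _ ih =>
    obtain ⟨h1, h2, -⟩ := ih h.1
    exact ⟨⟨h1, h2.trans h.2.1, h.2.2⟩, rfl, rfl⟩
  | lamRight _ ih =>
    obtain ⟨h1, h2, h3⟩ := ih h.2.2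
    exact ⟨⟨h.1, h.2.1, h1⟩, h2, h3⟩
  | appLeft _ ih =>
    obtain ⟨h1, h2, h3⟩ := ih h.1
    exact ⟨⟨h1, h.2⟩, h2, h3⟩
  | appRight _ ih =>
    obtain ⟨h1, h2, -⟩ := ih h.2.1
    exact ⟨⟨h.1, h1, h2.trans h.2.2⟩, rfl, rfl⟩

theorem reds {t t' : Tm CCConst} (h : Stratified t) (hr : Reds t t') :
    Stratified t' ∧ level t' = level t ∧ shape t' = shape t := by
  induction hr with
  | refl => exact ⟨h, rfl, rfl⟩
  | tail _ hr ih =>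
    obtain ⟨h1, h2, h3⟩ := ih
    obtain ⟨h4, h5, h6⟩ := h1.red hr
    exact ⟨h4, h5.trans h2, h6.trans h3⟩

theorem conv {t t' : Tm CCConst} (h : Stratified t) (h' : Stratified t') (hc : Conv rules t t') :
    level t = level t' ∧ shape t = shape t' := by
  obtain ⟨w, h1, h2⟩ := hc.join
  obtain ⟨-, h3, h4⟩ := h.reds h1
  obtain ⟨-, h5, h6⟩ := h'.reds h2
  exact ⟨h3.symm.trans h5, h4.symm.trans h6⟩

end Stratified

theorem stratified_constType (c : CCConst) :
    Stratified (constType c) ∧ level (constType c) = level (const c) + 1 := by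
  cases c <;> simp [constType, dotPiType, Tm.arrow, U, eps, rename, Stratified, level]

/-- Typed terms are stratified, and the type of a term is one level above it. The conversion rule is
no obstacle, since levels are invariant under the conversion of all stratified terms. -/
theorem Typ.stratified_of_lookup {Γ : Ctx CCConst} {t A : Tm CCConst} (h : Typ Γ t A)
    (hΓ : ∀ n T, Lookup Γ n T → Stratified T ∧ level T = 1) :
    Stratified t ∧ Stratified A ∧ level A = level t + 1 := by
  have push : ∀ {Γ : Ctx CCConst} {A : Tm CCConst},
      (∀ n T, Lookup Γ n T → Stratified T ∧ level T = 1) → Stratified A → level A = 1 →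
      ∀ n T, Lookup (A :: Γ) n T → Stratified T ∧ level T = 1 := by
    rintro Γ A hΓ hA hl _ _ (_ | h)
    · exact ⟨hA.rename _, (level_rename _ _).trans hl⟩
    · exact ⟨(hΓ _ _ h).1.rename _, (level_rename _ _).trans (hΓ _ _ h).2⟩
  induction h with
  | sort => exact ⟨trivial, trivial, rfl⟩
  | var h => exact ⟨trivial, hΓ _ _ h⟩
  | const c => exact ⟨trivial, stratified_constType c⟩
  | pi _ _ ihA ihB =>
    obtain ⟨h1, -, h2⟩ := ihA hΓ
    have h2 : level _ = 1 := (Nat.succ.inj h2).symm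
    obtain ⟨h3, -, h4⟩ := ihB (push hΓ h1 h2)
    exact ⟨⟨h1, h2, h3⟩, trivial, h4⟩
  | lam _ _ _ ihA ihB iht =>
    obtain ⟨h1, -, h2⟩ := ihA hΓ
    have h2 : level _ = 1 := (Nat.succ.inj h2).symm
    obtain ⟨h3, h4, h5⟩ := iht (push hΓ h1 h2)
    exact ⟨⟨h1, h2, h3⟩, ⟨h1, h2, h4⟩, h5⟩
  | app _ _ iht ihu =>
    obtain ⟨h1, h2, h3⟩ := iht hΓ
    obtain ⟨h4, h5, h6⟩ := ihu hΓ
    have hu : level _ = 0 := Nat.succ.inj (h6.symm.trans h2.2.1)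
    exact ⟨⟨h1, h4, hu⟩, h2.2.2.inst h4 hu, (level_inst _ hu).trans h3⟩
  | conv _ _ _ hc _ ihB iht =>
    obtain ⟨h1, h2, h3⟩ := iht hΓ
    have h4 := (ihB hΓ).1
    exact ⟨h1, h4, (h2.conv h4 hc).1.symm.trans h3⟩

theorem CtxOk.stratified {Γ : Ctx CCConst} (hΓ : CtxOk Γ) {n : ℕ} {T : Tm CCConst}
    (h : Lookup Γ n T) : Stratified T ∧ level T = 1 := by
  induction hΓ generalizing n T with
  | nil => cases h
  | cons _ hA ih =>
    cases h with
    | zero =>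
      obtain ⟨h1, -, h2⟩ := hA.stratified_of_lookup fun _ _ => ih
      exact ⟨h1.rename _, (level_rename _ _).trans (Nat.succ.inj h2).symm⟩
    | succ h => exact ⟨(ih h).1.rename _, (level_rename _ _).trans (ih h).2⟩

theorem Typ.stratified {Γ : Ctx CCConst} {t A : Tm CCConst} (h : Typ Γ t A) (hΓ : CtxOk Γ) :
    Stratified t ∧ Stratified A ∧ level A = level t + 1 :=
  h.stratified_of_lookup fun _ _ => hΓ.stratified

theorem Typ.level_eq_one {Γ : Ctx CCConst} {A : Tm CCConst} (h : Typ Γ A (.sort .type))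
    (hΓ : CtxOk Γ) : level A = 1 := (Nat.succ.inj (h.stratified hΓ).2.2).symm

/-- The elements of a type are objects. -/
theorem Typ.level_eq_zero {Γ : Ctx CCConst} {A u : Tm CCConst} (h : Typ Γ u A)
    (hA : Typ Γ A (.sort .type)) (hΓ : CtxOk Γ) : level u = 0 :=
  Nat.succ.inj ((h.stratified hΓ).2.2.symm.trans (hA.level_eq_one hΓ))

/-! ### Carriers -/

/-- Extend a valuation of the variables by a value for the variable `0`. -/
def push (c : ZFSet.{0}) (ψ : ℕ → ZFSet.{0}) : ℕ → ZFSet.{0}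
  | 0 => c
  | n + 1 => ψ n

theorem push_comp_upr (c : ZFSet) (ψ : ℕ → ZFSet) (f : ℕ → ℕ) :
    push c ψ ∘ upr f = push c (ψ ∘ f) := by
  funext n; cases n <;> rfl

/-- The function that maps the carrier of `X : U_s` to the carrier of `ε_s X`. -/
noncomputable def epsCarrier : Srt → ZFSet.{0}
  | .type => ZF.lam unit fun _ => unit
  | .kind => ZF.lam kinds fun c => c

/-- The carriers of the constants. The type of `Π_⟨s,Type,Type⟩` has the shape `{∅}`, so that the
carrier of this constant is `∅`. -/
noncomputable def constCarrier : CCConst → ZFSet.{0}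
  | .U .type => two
  | .U .kind => unit
  | .dotType => two
  | .eps s => epsCarrier s
  | .dotPi _ .type => ∅
  | .dotPi s .kind => ZF.lam (shape (U s)) fun a => ZF.lam (ZF.pi unit fun _ => kinds) fun f =>
      ZF.pi unit fun c => ZF.pi (ZF.app (epsCarrier s) a) fun _ => ZF.app f c

/-- The second layer of the model, under a valuation of the variables by elements of the shapes of
their types. The carrier of a type is the set of the truth values, or functions into truth values,
that may interpret its elements; the carrier of a function maps the carrier of an argument to a
carrier. Propositions have the carrier `{∅}`, whatever they are. -/
noncomputable def carrier : Tm CCConst → (ℕ → ZFSet.{0}) → ZFSet.{0}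
  | var n, ψ => ψ n
  | const c, _ => constCarrier c
  | sort _, _ => two
  | pi A B, ψ => ZF.pi (shape A) fun c => ZF.pi (carrier A ψ) fun _ => carrier B (push c ψ)
  | lam A t, ψ => ZF.lam (shape A) fun c => carrier t (push c ψ)
  | app t u, ψ => ZF.app (carrier t ψ) (carrier u ψ)

theorem carrier_rename (t : Tm CCConst) (f : ℕ → ℕ) (ψ : ℕ → ZFSet) :
    carrier (t.rename f) ψ = carrier t (ψ ∘ f) := by
  induction t generalizing f ψ <;> simp_all [rename, carrier, shape_rename, push_comp_upr]

theorem carrier_rename_succ (t : Tm CCConst) (c : ZFSet) (ψ : ℕ → ZFSet) :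
    carrier (t.rename Nat.succ) (push c ψ) = carrier t ψ := carrier_rename _ _ _

theorem carrier_ups (σ : ℕ → Tm CCConst) (c : ZFSet) (ψ : ℕ → ZFSet) :
    (fun n => carrier (ups σ n) (push c ψ)) = push c fun n => carrier (σ n) ψ := by
  funext n
  cases n with
  | zero => rfl
  | succ n => exact carrier_rename_succ _ _ _

theorem carrier_subst (t : Tm CCConst) {σ : ℕ → Tm CCConst} (hσ : ∀ n, level (σ n) = 0)
    (ψ : ℕ → ZFSet) : carrier (t.subst σ) ψ = carrier t fun n => carrier (σ n) ψ := by
  induction t generalizing σ ψ with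
  | var n => rfl
  | const c => rfl
  | sort s => rfl
  | pi A B ihA ihB =>
    simp only [subst, carrier, shape_subst A hσ, ihA hσ, ihB (level_ups hσ), carrier_ups]
  | lam A t ihA iht =>
    simp only [subst, carrier, shape_subst A hσ, iht (level_ups hσ), carrier_ups]
  | app t u iht ihu => simp only [subst, carrier, iht hσ, ihu hσ]

theorem carrier_inst (t : Tm CCConst) {u : Tm CCConst} (hu : level u = 0) (ψ : ℕ → ZFSet) :
    carrier (t.inst u) ψ = carrier t (push (carrier u ψ) ψ) := by
  rw [inst, carrier_subst t (level_single hu)]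
  congr 1; funext n; cases n <;> rfl

/-- The valuation `ψ` gives each variable of `Γ` an element of the shape of its type. -/
def ShapeVal (Γ : Ctx CCConst) (ψ : ℕ → ZFSet.{0}) : Prop :=
  ∀ n T, Lookup Γ n T → ψ n ∈ shape T

theorem ShapeVal.push {Γ : Ctx CCConst} {ψ : ℕ → ZFSet} {A : Tm CCConst} {c : ZFSet}
    (h : ShapeVal Γ ψ) (hc : c ∈ shape A) : ShapeVal (A :: Γ) (push c ψ) := by
  rintro _ _ (_ | h')
  · rwa [shape_rename]
  · rw [shape_rename]
    exact h _ _ h'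

theorem app_epsCarrier_type {a : ZFSet} (ha : a ∈ unit) :
    ZF.app (epsCarrier .type) a = unit := by
  rw [epsCarrier, ZF.app_lam _ ha]

theorem app_epsCarrier_kind {a : ZFSet} (ha : a ∈ kinds) :
    ZF.app (epsCarrier .kind) a = a := by
  rw [epsCarrier, ZF.app_lam _ ha]

theorem dotPi_carrier_mem {s : Srt} {a f : ZFSet} (ha : a ∈ shape (U s))
    (hf : f ∈ ZF.pi unit fun _ => kinds) :
    (ZF.pi unit fun c => ZF.pi (ZF.app (epsCarrier s) a) fun _ => ZF.app f c) ∈ kinds := by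
  have h1 : ZF.app (epsCarrier s) a ∈ kinds := by
    cases s with
    | type =>
      rw [app_epsCarrier_type ha]
      exact unit_mem_kinds
    | kind => rwa [app_epsCarrier_kind ha]
  rw [ZF.pi_congr (B' := fun _ => ZF.pi (ZF.app (epsCarrier s) a) fun _ => ZF.app f ∅)
    fun c hc => by rw [ZF.mem_unit.1 hc]]
  exact arrow_mem_kinds h1 (ZF.app_mem hf (ZF.mem_unit.2 rfl))

theorem constCarrier_mem {c : CCConst} (h : level (const c) = 0) :
    constCarrier c ∈ shape (constType c) := by
  cases c with
  | U s => cases h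
  | dotType => exact two_mem_kinds
  | eps s => cases h
  | dotPi s₁ s₂ =>
    cases s₂ with
    | type =>
      have h : shape (constType (.dotPi s₁ .type)) =
          ZF.pi (shape (U s₁)) fun _ => ZF.pi (ZF.pi unit fun _ => unit) fun _ => unit := rfl
      rw [h]
      simp only [ZF.pi_unit]
      exact ZF.mem_unit.2 rfl
    | kind => exact ZF.lam_mem_pi fun a ha => ZF.lam_mem_pi fun f hf => dotPi_carrier_mem ha hf

theorem Typ.carrier_mem {Γ : Ctx CCConst} {t A : Tm CCConst} (h : Typ Γ t A) (hΓ : CtxOk Γ)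
    {ψ : ℕ → ZFSet} (hψ : ShapeVal Γ ψ) (hl : level A = 1) : carrier t ψ ∈ shape A := by
  induction h generalizing ψ with
  | sort => cases hl
  | var h => exact hψ _ _ h
  | const c => exact constCarrier_mem (Nat.succ.inj ((stratified_constType c).2.symm.trans hl))
  | @pi _ _ _ s => cases s <;> cases hl
  | lam hA _ _ _ _ ih => exact ZF.lam_mem_pi fun c hc => ih (hΓ.cons hA) (hψ.push hc) hl
  | app ht hu iht ihu =>
    obtain ⟨hA, -⟩ := ht.pi_isType hΓ
    have hu0 := hu.level_eq_zero hA hΓ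
    rw [level_inst _ hu0] at hl
    rw [shape_inst _ hu0]
    exact ZF.app_mem (iht hΓ hψ hl) (ihu hΓ hψ (hA.level_eq_one hΓ))
  | conv _ hB ht hc _ _ ih =>
    obtain ⟨h1, h2⟩ := (ht.stratified hΓ).2.1.conv (hB.stratified hΓ).1 hc
    rw [← h2]
    exact ih hΓ hψ (h1.trans hl)

/-- The carrier of an element of a type belongs to the shape of this type. -/
theorem Typ.carrier_mem_shape {Γ : Ctx CCConst} {t A : Tm CCConst} (h : Typ Γ t A)
    (hA : Typ Γ A (.sort .type)) (hΓ : CtxOk Γ) {ψ : ℕ → ZFSet} (hψ : ShapeVal Γ ψ) :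
    carrier t ψ ∈ shape A := h.carrier_mem hΓ hψ (hA.level_eq_one hΓ)

/-- The rule for products preserves carriers. Over `U_Type` the two sides have the carrier `{∅}`, over
`U_Kind` the left-hand side has the carrier of the right-hand side by definition. -/
theorem carrier_dotPi {s₁ s₂ : Srt} {X Y : Tm CCConst} {ψ : ℕ → ZFSet}
    (hX : carrier X ψ ∈ shape (U s₁)) (hY : carrier Y ψ ∈ ZF.pi unit fun _ => shape (U s₂)) :
    carrier (eps s₂ (dotPi s₁ s₂ X Y)) ψ =
      carrier (pi (eps s₁ X) (eps s₂ (app (Y.rename Nat.succ) (var 0)))) ψ := by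
  have hr : carrier (pi (eps s₁ X) (eps s₂ (app (Y.rename Nat.succ) (var 0)))) ψ =
      ZF.pi unit fun c => ZF.pi (ZF.app (epsCarrier s₁) (carrier X ψ)) fun _ =>
        ZF.app (epsCarrier s₂) (ZF.app (carrier Y ψ) c) := by
    simp only [carrier, eps, constCarrier, carrier_rename_succ]
    rfl
  rw [hr]
  cases s₂ with
  | type =>
    have h : ∀ c ∈ unit, ZF.app (epsCarrier .type) (ZF.app (carrier Y ψ) c) = unit :=
      fun c hc => app_epsCarrier_type (ZF.app_mem hY hc)
    rw [ZF.pi_congr fun c hc => ZF.pi_congr fun _ _ => h c hc]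
    simp only [ZF.pi_unit]
    refine app_epsCarrier_type ?_
    have h : ∀ x, ZF.app ∅ x = ∅ := fun x => by
      ext y
      simp [ZF.mem_app]
    exact ZF.mem_unit.2 ((congrArg (ZF.app · _) (h _)).trans (h _))
  | kind =>
    rw [ZF.pi_congr fun c hc => ZF.pi_congr fun _ _ => app_epsCarrier_kind (ZF.app_mem hY hc)]
    have h : carrier (dotPi s₁ .kind X Y) ψ = ZF.pi unit fun c =>
        ZF.pi (ZF.app (epsCarrier s₁) (carrier X ψ)) fun _ => ZF.app (carrier Y ψ) c := by
      simp only [carrier, dotPi, constCarrier]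
      rw [ZF.app_lam _ hX]
      exact ZF.app_lam _ hY
    rw [eps, carrier, h]
    exact app_epsCarrier_kind (dotPi_carrier_mem hX hY)

theorem Typ.carrier_red {Γ : Ctx CCConst} {t t' A : Tm CCConst} (h : Typ Γ t A) (hΓ : CtxOk Γ)
    (hr : Red t t') {ψ : ℕ → ZFSet} (hψ : ShapeVal Γ ψ) : carrier t ψ = carrier t' ψ := by
  induction hr generalizing Γ A ψ with
  | root hr =>
    rcases hr with ⟨C, t, u⟩ | hr
    · obtain ⟨A, B, ht, hu, -⟩ := h.app_inv
      obtain ⟨_, _, hC, hu, -⟩ := ht.beta_inv hΓ hu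
      rw [carrier_inst t (hu.level_eq_zero hC hΓ)]
      exact ZF.app_lam _ (hu.carrier_mem_shape hC hΓ hψ)
    · rcases rewrite_iff.1 hr with _ | ⟨s₁, s₂, X, Y⟩
      · exact app_epsCarrier_kind two_mem_kinds
      · obtain ⟨A, B, ht, hu, -⟩ := h.app_inv
        obtain ⟨hX, hY⟩ := (ht.eps_inv hΓ hu).1.dotPi_inv hΓ
        exact carrier_dotPi (hX.carrier_mem_shape (.U _) hΓ hψ)
          (hY.carrier_mem_shape (.arrow hX.eps (.U _)) hΓ hψ)
  | piLeft hr ih =>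
    obtain ⟨hA, -⟩ := h.pi_inv
    simp only [carrier, ih hA hΓ hψ, ((hA.stratified hΓ).1.red hr).2.2]
  | piRight _ ih =>
    obtain ⟨hA, _, hB⟩ := h.pi_inv
    exact ZF.pi_congr fun c hc => ZF.pi_congr fun _ _ => ih hB (hΓ.cons hA) (hψ.push hc)
  | lamLeft hr ih =>
    obtain ⟨_, _, hA, -⟩ := h.lam_inv
    simp only [carrier, ((hA.stratified hΓ).1.red hr).2.2]
  | lamRight _ ih =>
    obtain ⟨_, _, hA, -, ht, -⟩ := h.lam_inv
    exact ZF.lam_congr fun c hc => ih ht (hΓ.cons hA) (hψ.push hc)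
  | appLeft _ ih =>
    obtain ⟨_, _, ht, -⟩ := h.app_inv
    simp only [carrier, ih ht hΓ hψ]
  | appRight _ ih =>
    obtain ⟨_, _, -, hu, -⟩ := h.app_inv
    simp only [carrier, ih hu hΓ hψ]

/-- Convertible types have the same carrier. -/
theorem Typ.carrier_conv {Γ : Ctx CCConst} {t u A B : Tm CCConst} (ht : Typ Γ t A)
    (hu : Typ Γ u B) (hΓ : CtxOk Γ) (hc : Conv rules t u) {ψ : ℕ → ZFSet} (hψ : ShapeVal Γ ψ) :
    carrier t ψ = carrier u ψ :=
  ht.conv_induction (f := fun t => carrier t ψ) hΓ (fun _ _ _ h hr => h.carrier_red hΓ hr hψ) hu hc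

/-! ### Values -/

/-- The function that maps the carrier and the value of `X : U_s` to the truth value of `ε_s X`. -/
noncomputable def epsValue : Srt → ZFSet.{0}
  | .type => ZF.lam unit fun _ => ZF.lam two fun d => d
  | .kind => ZF.lam kinds fun _ => ZF.lam unit fun _ => ZF.true

/-- The values of the constants. An element of `U_Kind`, or a function into `U_Kind`, has the value
`∅`, as its type has the carrier `{∅}`. The value of `Π_⟨s,Type,Type⟩` is a quantifier: `c` and `d` are
the carrier and the value of the domain `X`, and `h` is the value of the family `Y`, whose carrier is
ignored. -/
noncomputable def constValue : CCConst → ZFSet.{0}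
  | .U _ => ZF.true
  | .dotType => ∅
  | .eps s => epsValue s
  | .dotPi _ .kind => ∅
  | .dotPi s .type => ZF.lam (shape (U s)) fun c => ZF.lam (constCarrier (.U s)) fun d =>
      ZF.lam unit fun _ => ZF.lam (ZF.pi unit fun _ => ZF.pi (ZF.app (epsCarrier s) c) fun _ => two)
        fun h => truth (ZF.app (ZF.app (epsValue s) c) d = ZF.true →
          ∀ e ∈ unit, ∀ z ∈ ZF.app (epsCarrier s) c, ZF.app (ZF.app h e) z = ZF.true)

/-- The third layer of the model, under a valuation of the variables by elements of the shapes of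
their types and a valuation by elements of the carriers of their types. The value of a type is a
truth value; a function takes the carrier and the value of its argument. -/
noncomputable def value : Tm CCConst → (ℕ → ZFSet.{0}) → (ℕ → ZFSet.{0}) → ZFSet.{0}
  | var n, _, φ => φ n
  | const c, _, _ => constValue c
  | sort _, _, _ => ZF.true
  | pi A B, ψ, φ => truth (value A ψ φ = ZF.true → ∀ c ∈ shape A, ∀ d ∈ carrier A ψ,
      value B (push c ψ) (push d φ) = ZF.true)
  | lam A t, ψ, φ => ZF.lam (shape A) fun c => ZF.lam (carrier A ψ) fun d =>
      value t (push c ψ) (push d φ)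
  | app t u, ψ, φ => ZF.app (ZF.app (value t ψ φ) (carrier u ψ)) (value u ψ φ)

theorem value_rename (t : Tm CCConst) (f : ℕ → ℕ) (ψ φ : ℕ → ZFSet) :
    value (t.rename f) ψ φ = value t (ψ ∘ f) (φ ∘ f) := by
  induction t generalizing f ψ φ <;>
    simp_all [rename, value, shape_rename, carrier_rename, push_comp_upr]

theorem value_rename_succ (t : Tm CCConst) (c d : ZFSet) (ψ φ : ℕ → ZFSet) :
    value (t.rename Nat.succ) (push c ψ) (push d φ) = value t ψ φ := value_rename _ _ _ _

theorem value_ups (σ : ℕ → Tm CCConst) (c d : ZFSet) (ψ φ : ℕ → ZFSet) :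
    (fun n => value (ups σ n) (push c ψ) (push d φ)) = push d fun n => value (σ n) ψ φ := by
  funext n
  cases n with
  | zero => rfl
  | succ n => exact value_rename_succ _ _ _ _ _

theorem value_subst (t : Tm CCConst) {σ : ℕ → Tm CCConst} (hσ : ∀ n, level (σ n) = 0)
    (ψ φ : ℕ → ZFSet) : value (t.subst σ) ψ φ =
      value t (fun n => carrier (σ n) ψ) (fun n => value (σ n) ψ φ) := by
  induction t generalizing σ ψ φ with
  | var n => rfl
  | const c => rfl
  | sort s => rfl
  | pi A B ihA ihB =>
    simp only [subst, value, shape_subst A hσ, carrier_subst A hσ, ihA hσ, ihB (level_ups hσ),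
      carrier_ups, value_ups]
  | lam A t ihA iht =>
    simp only [subst, value, shape_subst A hσ, carrier_subst A hσ, iht (level_ups hσ),
      carrier_ups, value_ups]
  | app t u iht ihu => simp only [subst, value, carrier_subst u hσ, iht hσ, ihu hσ]

theorem value_inst (t : Tm CCConst) {u : Tm CCConst} (hu : level u = 0) (ψ φ : ℕ → ZFSet) :
    value (t.inst u) ψ φ = value t (push (carrier u ψ) ψ) (push (value u ψ φ) φ) := by
  rw [inst, value_subst t (level_single hu)]
  congr 1 <;> funext n <;> cases n <;> rfl

/-- The valuation `φ` gives each variable of `Γ` an element of the carrier of its type. -/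
def CarrierVal (Γ : Ctx CCConst) (ψ φ : ℕ → ZFSet.{0}) : Prop :=
  ∀ n T, Lookup Γ n T → φ n ∈ carrier T ψ

theorem CarrierVal.push {Γ : Ctx CCConst} {ψ φ : ℕ → ZFSet} {A : Tm CCConst} {c d : ZFSet}
    (h : CarrierVal Γ ψ φ) (hd : d ∈ carrier A ψ) :
    CarrierVal (A :: Γ) (push c ψ) (push d φ) := by
  rintro _ _ (_ | h')
  · rwa [carrier_rename_succ]
  · rw [carrier_rename_succ]
    exact h _ _ h'

theorem app_epsValue_type {c d : ZFSet} (hc : c ∈ unit) (hd : d ∈ two) :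
    ZF.app (ZF.app (epsValue .type) c) d = d := by
  rw [epsValue, ZF.app_lam _ hc, ZF.app_lam _ hd]

theorem app_epsValue_kind {c d : ZFSet} (hc : c ∈ kinds) (hd : d ∈ unit) :
    ZF.app (ZF.app (epsValue .kind) c) d = ZF.true := by
  rw [epsValue, ZF.app_lam _ hc, ZF.app_lam _ hd]

theorem constValue_mem (c : CCConst) (ψ : ℕ → ZFSet) :
    constValue c ∈ carrier (constType c) ψ := by
  cases c with
  | U s => exact ZF.true_mem_two
  | dotType => exact ZF.mem_unit.2 rfl
  | eps s =>
    cases s with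
    | type => exact ZF.lam_mem_pi fun _ _ => ZF.lam_mem_pi fun _ hd => hd
    | kind => exact ZF.lam_mem_pi fun _ _ => ZF.lam_mem_pi fun _ _ => ZF.true_mem_two
  | dotPi s₁ s₂ =>
    cases s₂ with
    | type =>
      have h : shape ((arrow (eps s₁ (var 0)) (U .type))) = unit := ZF.pi_unit _
      refine ZF.lam_mem_pi fun c _ => ZF.lam_mem_pi fun d _ => ?_
      simp only [arrow, carrier] at h ⊢
      rw [h]
      exact ZF.lam_mem_pi fun _ _ => ZF.lam_mem_pi fun _ _ => ZF.truth_mem_two _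
    | kind =>
      have h : ∀ ψ, carrier (U .kind) ψ = unit := fun _ => rfl
      simp only [constType, dotPiType, arrow, carrier, carrier_rename, h, ZF.pi_unit]
      exact ZF.mem_unit.2 rfl

theorem Typ.value_mem {Γ : Ctx CCConst} {t A : Tm CCConst} (h : Typ Γ t A) (hΓ : CtxOk Γ)
    {ψ φ : ℕ → ZFSet} (hψ : ShapeVal Γ ψ) (hφ : CarrierVal Γ ψ φ) :
    value t ψ φ ∈ carrier A ψ := by
  induction h generalizing ψ φ with
  | sort => exact ZF.true_mem_two
  | var h => exact hφ _ _ h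
  | const c => exact constValue_mem c ψ
  | pi => exact ZF.truth_mem_two _
  | lam hA _ _ _ _ ih =>
    exact ZF.lam_mem_pi fun c hc => ZF.lam_mem_pi fun d hd =>
      ih (hΓ.cons hA) (hψ.push hc) (hφ.push hd)
  | app ht hu iht ihu =>
    obtain ⟨hA, -⟩ := ht.pi_isType hΓ
    rw [carrier_inst _ (hu.level_eq_zero hA hΓ)]
    exact ZF.app_mem (ZF.app_mem (iht hΓ hψ hφ) (hu.carrier_mem_shape hA hΓ hψ)) (ihu hΓ hψ hφ)
  | conv hA hB _ hc _ _ ih =>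
    rw [← hA.carrier_conv hB hΓ hc hψ]
    exact ih hΓ hψ hφ

/-- The rule for products preserves values: the quantifier that interprets `Π_⟨s,Type,Type⟩` agrees
with the truth value of a product, and a product of elements of `U_Kind` is true. -/
theorem value_dotPi {s₁ s₂ : Srt} {X Y : Tm CCConst} {ψ φ : ℕ → ZFSet}
    (hX : carrier X ψ ∈ shape (U s₁)) (hX' : value X ψ φ ∈ constCarrier (.U s₁))
    (hY : carrier Y ψ ∈ shape (arrow (eps s₁ X) (U s₂)))
    (hY' : value Y ψ φ ∈ carrier (arrow (eps s₁ X) (U s₂)) ψ)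
    (hP : carrier (dotPi s₁ s₂ X Y) ψ ∈ shape (U s₂))
    (hP' : value (dotPi s₁ s₂ X Y) ψ φ ∈ carrier (U s₂) ψ) :
    value (eps s₂ (dotPi s₁ s₂ X Y)) ψ φ =
      value (pi (eps s₁ X) (eps s₂ (app (Y.rename Nat.succ) (var 0)))) ψ φ := by
  have hr : value (pi (eps s₁ X) (eps s₂ (app (Y.rename Nat.succ) (var 0)))) ψ φ =
      truth (ZF.app (ZF.app (epsValue s₁) (carrier X ψ)) (value X ψ φ) = ZF.true →
        ∀ c ∈ unit, ∀ d ∈ ZF.app (epsCarrier s₁) (carrier X ψ),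
          ZF.app (ZF.app (epsValue s₂) (ZF.app (carrier Y ψ) c))
            (ZF.app (ZF.app (value Y ψ φ) c) d) = ZF.true) := by
    simp only [value, carrier, eps, constValue, constCarrier, carrier_rename_succ,
      value_rename_succ]
    rfl
  have h1 : ∀ c ∈ unit, ZF.app (carrier Y ψ) c ∈ shape (U s₂) := fun c hc => ZF.app_mem hY hc
  have h2 : ∀ c ∈ unit, ∀ d ∈ ZF.app (epsCarrier s₁) (carrier X ψ),
      ZF.app (ZF.app (value Y ψ φ) c) d ∈ constCarrier (.U s₂) := fun c hc d hd =>
    ZF.app_mem (B := fun _ => constCarrier (.U s₂)) (ZF.app_mem hY' hc) hd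
  rw [hr]
  cases s₂ with
  | type =>
    refine (app_epsValue_type hP hP').trans ?_
    have h3 : value Y ψ φ ∈
        ZF.pi unit fun _ => ZF.pi (ZF.app (epsCarrier s₁) (carrier X ψ)) fun _ => two := hY'
    have hY0 : carrier Y ψ ∈ unit := ZF.pi_unit unit ▸ hY
    have h4 : value (dotPi s₁ .type X Y) ψ φ =
        truth (ZF.app (ZF.app (epsValue s₁) (carrier X ψ)) (value X ψ φ) = ZF.true →
          ∀ c ∈ unit, ∀ d ∈ ZF.app (epsCarrier s₁) (carrier X ψ),
            ZF.app (ZF.app (value Y ψ φ) c) d = ZF.true) := by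
      simp only [value, dotPi, constValue]
      rw [ZF.app_lam _ hX, ZF.app_lam _ hX', ZF.app_lam _ hY0, ZF.app_lam _ h3]
    rw [h4]
    congr 1
    refine propext (imp_congr_right fun _ => forall₂_congr fun c hc => forall₂_congr fun d hd => ?_)
    rw [app_epsValue_type (h1 c hc) (h2 c hc d hd)]
  | kind =>
    refine (app_epsValue_kind hP hP').trans (ZF.truth_eq_true.2 fun _ c hc d hd => ?_).symm
    exact app_epsValue_kind (h1 c hc) (h2 c hc d hd)

theorem Typ.value_red {Γ : Ctx CCConst} {t t' A : Tm CCConst} (h : Typ Γ t A) (hΓ : CtxOk Γ)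
    (hr : Red t t') {ψ φ : ℕ → ZFSet} (hψ : ShapeVal Γ ψ) (hφ : CarrierVal Γ ψ φ) :
    value t ψ φ = value t' ψ φ := by
  induction hr generalizing Γ A ψ φ with
  | root hr =>
    rcases hr with ⟨C, t, u⟩ | hr
    · obtain ⟨A, B, ht, hu, -⟩ := h.app_inv
      obtain ⟨_, _, hC, hu, -⟩ := ht.beta_inv hΓ hu
      rw [value_inst t (hu.level_eq_zero hC hΓ), value, value,
        ZF.app_lam _ (hu.carrier_mem_shape hC hΓ hψ), ZF.app_lam _ (hu.value_mem hΓ hψ hφ)]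
    · rcases rewrite_iff.1 hr with _ | ⟨s₁, s₂, X, Y⟩
      · exact app_epsValue_kind two_mem_kinds (ZF.mem_unit.2 rfl)
      · obtain ⟨A, B, ht, hu, -⟩ := h.app_inv
        have hP := (ht.eps_inv hΓ hu).1
        obtain ⟨hX, hY⟩ := hP.dotPi_inv hΓ
        exact value_dotPi (hX.carrier_mem_shape (.U _) hΓ hψ) (hX.value_mem hΓ hψ hφ)
          (hY.carrier_mem_shape (.arrow hX.eps (.U _)) hΓ hψ) (hY.value_mem hΓ hψ hφ)
          (hP.carrier_mem_shape (.U _) hΓ hψ) (hP.value_mem hΓ hψ hφ)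
  | piLeft hr ih =>
    obtain ⟨hA, -⟩ := h.pi_inv
    simp only [value, ih hA hΓ hψ hφ, ((hA.stratified hΓ).1.red hr).2.2, hA.carrier_red hΓ hr hψ]
  | piRight _ ih =>
    obtain ⟨hA, _, hB⟩ := h.pi_inv
    refine congrArg truth (propext (imp_congr_right fun _ => forall₂_congr fun c hc =>
      forall₂_congr fun d hd => ?_))
    rw [ih hB (hΓ.cons hA) (hψ.push hc) (hφ.push hd)]
  | lamLeft hr ih =>
    obtain ⟨_, _, hA, -⟩ := h.lam_inv
    simp only [value, ((hA.stratified hΓ).1.red hr).2.2, hA.carrier_red hΓ hr hψ]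
  | lamRight _ ih =>
    obtain ⟨_, _, hA, -, ht, -⟩ := h.lam_inv
    exact ZF.lam_congr fun c hc => ZF.lam_congr fun d hd =>
      ih ht (hΓ.cons hA) (hψ.push hc) (hφ.push hd)
  | appLeft _ ih =>
    obtain ⟨_, _, ht, -⟩ := h.app_inv
    simp only [value, ih ht hΓ hψ hφ]
  | appRight hr ih =>
    obtain ⟨_, _, -, hu, -⟩ := h.app_inv
    simp only [value, ih hu hΓ hψ hφ, hu.carrier_red hΓ hr hψ]

theorem Typ.value_conv {Γ : Ctx CCConst} {t u A B : Tm CCConst} (ht : Typ Γ t A)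
    (hu : Typ Γ u B) (hΓ : CtxOk Γ) (hc : Conv rules t u) {ψ φ : ℕ → ZFSet}
    (hψ : ShapeVal Γ ψ) (hφ : CarrierVal Γ ψ φ) : value t ψ φ = value u ψ φ :=
  ht.conv_induction (f := fun t => value t ψ φ) hΓ
    (fun _ _ _ h hr => h.value_red hΓ hr hψ hφ) hu hc

theorem value_constType (c : CCConst) (ψ φ : ℕ → ZFSet) :
    value (constType c) ψ φ = ZF.true := by
  cases c with
  | U s => rfl
  | dotType => rfl
  | eps s => exact ZF.truth_eq_true.2 fun _ _ _ _ _ => rfl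
  | dotPi s₁ s₂ =>
    exact ZF.truth_eq_true.2 fun _ _ _ _ _ => ZF.truth_eq_true.2 fun _ _ _ _ _ => rfl

/-- Soundness: an inhabited type is true under every valuation that makes the types of the context
true. -/
theorem Typ.value_eq_true {Γ : Ctx CCConst} {t A : Tm CCConst} (h : Typ Γ t A) (hΓ : CtxOk Γ)
    {ψ φ : ℕ → ZFSet} (hψ : ShapeVal Γ ψ) (hφ : CarrierVal Γ ψ φ)
    (hv : ∀ n T, Lookup Γ n T → value T ψ φ = ZF.true) : value A ψ φ = ZF.true := by
  induction h generalizing ψ φ with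
  | sort => rfl
  | var h => exact hv _ _ h
  | const c => exact value_constType c ψ φ
  | pi => rfl
  | lam hA _ _ _ _ ih =>
    refine ZF.truth_eq_true.2 fun hA' c hc d hd => ih (hΓ.cons hA) (hψ.push hc) (hφ.push hd) ?_
    rintro _ _ (_ | h)
    · rwa [value_rename_succ]
    · rw [value_rename_succ]
      exact hv _ _ h
  | app ht hu iht ihu =>
    obtain ⟨hA, -⟩ := ht.pi_isType hΓ
    rw [value_inst _ (hu.level_eq_zero hA hΓ)]
    exact ZF.truth_eq_true.1 (iht hΓ hψ hφ hv) (ihu hΓ hψ hφ hv) _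
      (hu.carrier_mem_shape hA hΓ hψ) _ (hu.value_mem hΓ hψ hφ)
  | conv hA hB _ hc _ _ ih =>
    rw [← hA.value_conv hB hΓ hc hψ hφ]
    exact ih hΓ hψ hφ hv

/-- No term has type `ε_Type(x)` in the context `x : U_Type`: this type is false when the value of
`x` is false. -/
theorem not_typ_eps {t : Tm CCConst} : ¬ Typ [U .type] t (eps .type (var 0)) := by
  intro h
  have := h.value_eq_true (.cons .nil (.U .type)) (ψ := fun _ => ∅) (φ := fun _ => ∅)
    ?_ ?_ ?_
  · exact ZF.true_ne_empty
      (this.symm.trans (app_epsValue_type (ZF.mem_unit.2 rfl) ZF.empty_mem_two))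
  · rintro _ _ (_ | h)
    · exact ZF.mem_unit.2 rfl
    · cases h
  · rintro _ _ (_ | h)
    · exact ZF.empty_mem_two
    · cases h
  · rintro _ _ (_ | h)
    · rfl
    · cases h

end CC

/-! ### Translation of Simple type theory -/

namespace STT

/-- A Simple type as an element of `U_Kind`. Both base types become the type of propositions. -/
def code : SimpleType → Tm CCConst
  | .iota => CC.dotType
  | .o => CC.dotType
  | .arrow A B => CC.dotPi .kind .kind (code A) (lam (CC.eps .kind (code A)) (code B))

/-- The translation of the constants to closed terms. -/
def constToCC : STTConst → Tm CCConst
  | .iota => CC.U .type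
  | .o => CC.U .type
  | .eps => const (.eps .type)
  | .imp => lam (CC.U .type) (lam (CC.U .type)
      (CC.dotPi .type .type (var 1) (lam (CC.eps .type (var 1)) (var 1))))
  | .all A => app (const (.dotPi .kind .type)) (code A)

/-- The translation of Simple type theory to the Calculus of constructions. -/
def toCC : Tm STTConst → Tm CCConst
  | var n => var n
  | const c => constToCC c
  | sort s => sort s
  | pi A B => pi (toCC A) (toCC B)
  | lam A t => lam (toCC A) (toCC t)
  | app t u => app (toCC t) (toCC u)

theorem code_subst (A : SimpleType) (σ : ℕ → Tm CCConst) : (code A).subst σ = code A := by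
  induction A generalizing σ with
  | iota => rfl
  | o => rfl
  | arrow A B ihA ihB => simp [code, CC.dotPi, CC.eps, subst, ihA, ihB]

theorem code_rename (A : SimpleType) (f : ℕ → ℕ) : (code A).rename f = code A := by
  rw [rename_eq_subst, code_subst]

theorem constToCC_subst (c : STTConst) (σ : ℕ → Tm CCConst) :
    (constToCC c).subst σ = constToCC c := by
  cases c with
  | all A => simp [constToCC, subst, code_subst]
  | _ => rfl

theorem constToCC_rename (c : STTConst) (f : ℕ → ℕ) : (constToCC c).rename f = constToCC c := by
  rw [rename_eq_subst, constToCC_subst]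

theorem toCC_rename (t : Tm STTConst) (f : ℕ → ℕ) :
    toCC (t.rename f) = (toCC t).rename f := by
  induction t generalizing f <;> simp_all [rename, toCC, constToCC_rename]

theorem toCC_ups (σ : ℕ → Tm STTConst) : (fun n => toCC (ups σ n)) = ups fun n => toCC (σ n) := by
  funext n
  cases n with
  | zero => rfl
  | succ n => exact toCC_rename _ _

theorem toCC_subst (t : Tm STTConst) (σ : ℕ → Tm STTConst) :
    toCC (t.subst σ) = (toCC t).subst fun n => toCC (σ n) := by
  induction t generalizing σ <;> simp_all [subst, toCC, constToCC_subst, toCC_ups]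

theorem toCC_inst (t u : Tm STTConst) : toCC (t.inst u) = (toCC t).inst (toCC u) := by
  rw [inst, toCC_subst, inst]
  congr 1; funext n; cases n <;> rfl

theorem toCC_arrow (A B : Tm STTConst) : toCC (arrow A B) = arrow (toCC A) (toCC B) := by
  rw [arrow, toCC, toCC_rename, arrow]

theorem ofType_subst (A : SimpleType) (σ : ℕ → Tm STTConst) :
    (ofType A).subst σ = ofType A := by
  induction A generalizing σ with
  | iota => rfl
  | o => rfl
  | arrow A B ihA ihB => simp [ofType, arrow, rename_ofType, subst, ihA, ihB]

/-- A dependent product over a constant family is an arrow. -/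
theorem conv_dotPi_const (s₁ s₂ : Srt) (X Y : Tm CCConst) :
    Conv CC.rules (CC.eps s₂ (CC.dotPi s₁ s₂ X (lam (CC.eps s₁ X) (Y.rename Nat.succ))))
      (arrow (CC.eps s₁ X) (CC.eps s₂ Y)) := by
  refine (Conv.step (CC.Root.dotPi _ _ _ _).red).trans (.pi (.refl _) (.app (.refl _) ?_))
  refine (Conv.beta _ _ _).trans ?_
  rw [rename_succ_upr, rename_succ_inst]
  exact .refl _

theorem conv_code (A : SimpleType) :
    Conv CC.rules (CC.eps .kind (code A)) (toCC (ofType A)) := by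
  induction A with
  | iota => exact .step CC.Root.dotType.red
  | o => exact .step CC.Root.dotType.red
  | arrow A B ihA ihB =>
    have := conv_dotPi_const .kind .kind (code A) (code B)
    rw [code_rename] at this
    rw [ofType, toCC_arrow]
    exact this.trans (.pi ihA (ihB.rename _))

/-- The translation of `⇒` is a product over a constant family. -/
theorem conv_imp (X Y : Tm CCConst) : Conv CC.rules (app (app (constToCC .imp) X) Y)
    (CC.dotPi .type .type X (lam (CC.eps .type X) (Y.rename Nat.succ))) := by
  refine (Conv.app (Conv.beta _ _ _) (.refl _)).trans ((Conv.beta _ _ _).trans ?_)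
  have : (X.rename Nat.succ).subst (single Y) = X := rename_succ_inst X Y
  simp only [inst, subst, CC.dotPi, CC.eps, single, ups, this]
  exact .refl _

theorem conv_toCC_root {S : Finset SimpleType} {t u : Tm STTConst} (h : Rewrite (rules S) t u) :
    Conv CC.rules (toCC t) (toCC u) := by
  obtain ⟨ρ, rfl | ⟨A, -, rfl⟩, θ, rfl, rfl⟩ := h
  · have h : toCC (impRule.rhs.subst θ) =
        arrow (CC.eps .type (toCC (θ 1))) (CC.eps .type (toCC (θ 0))) := by
      change toCC (arrow (eps (θ 1)) (eps (θ 0))) = _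
      rw [toCC_arrow]
      rfl
    rw [h]
    exact (Conv.app (.refl _) (conv_imp _ _)).trans (conv_dotPi_const _ _ _ _)
  · have h : toCC ((allRule A).rhs.subst θ) = pi (toCC (ofType A))
        (CC.eps .type (app ((toCC (θ 0)).rename Nat.succ) (var 0))) := by
      rw [← toCC_rename, ← ofType_subst A θ]
      rfl
    rw [h]
    exact (Conv.step (CC.Root.dotPi .kind .type _ _).red).trans (.pi (conv_code A) (.refl _))

theorem conv_toCC {S : Finset SimpleType} {t u : Tm STTConst} (h : Conv (rules S) t u) :
    Conv CC.rules (toCC t) (toCC u) := by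
  refine h.map fun t u h => ?_
  induction h with
  | root h =>
    rcases h with ⟨A, t, u⟩ | h
    · rw [toCC_inst]
      exact .beta _ _ _
    · exact conv_toCC_root h
  | piLeft _ ih => exact .pi ih (.refl _)
  | piRight _ ih => exact .pi (.refl _) ih
  | lamLeft _ ih => exact .lam ih (.refl _)
  | lamRight _ ih => exact .lam (.refl _) ih
  | appLeft _ ih => exact .app ih (.refl _)
  | appRight _ ih => exact .app (.refl _) ih

open CC (Typ)

theorem typ_code (A : SimpleType) (Γ : Ctx CCConst) : Typ Γ (code A) (CC.U .kind) := by
  induction A generalizing Γ with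
  | iota => exact .const .dotType
  | o => exact .const .dotType
  | arrow A B ihA ihB => exact (ihA Γ).dotPi (.lam (ihA Γ).eps (.U .kind) (ihB _))

theorem typ_ofType (A : SimpleType) (Γ : Ctx CCConst) :
    Typ Γ (toCC (ofType A)) (sort .type) := by
  induction A generalizing Γ with
  | iota => exact .U _
  | o => exact .U _
  | arrow A B ihA ihB =>
    rw [ofType, toCC_arrow]
    exact .arrow (ihA Γ) (ihB Γ)

theorem typ_constToCC {S : Finset SimpleType} {c : STTConst} {A : Tm STTConst}
    (h : (c, A) ∈ sig S) (Γ : Ctx CCConst) : Typ Γ (constToCC c) (toCC A) := by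
  rcases List.mem_append.1 h with h | h
  · obtain ⟨A, -, h⟩ := List.mem_map.1 h
    cases h
    have h1 := (typ_code A Γ).eps.arrow (.U .type)
    have h2 := (typ_ofType A Γ).arrow (.U .type)
    rw [toCC_arrow, toCC_arrow]
    refine .conv (A := arrow (arrow (CC.eps .kind (code A)) (CC.U .type)) (CC.U .type))
      (h1.arrow (.U .type)) (h2.arrow (.U .type)) ?_ (.pi (.pi (conv_code A) (.refl _)) (.refl _))
    exact Typ.app (.const (.dotPi .kind .type)) (typ_code A Γ)
  · simp only [baseSig, List.mem_cons, Prod.mk.injEq, List.not_mem_nil, or_false] at h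
    rcases h with h | h | h | h <;> obtain ⟨rfl, rfl⟩ := h
    · have hX {Γ : Ctx CCConst} {A : Tm CCConst} :
          Typ (A :: CC.U .type :: Γ) (var 1) (CC.U .type) := .var (.succ .zero)
      exact .lam (.U _) (.pi (.U _) (.U _)) (.lam (.U _) (.U _)
        (hX.dotPi (.lam hX.eps (.U _) (.var (.succ .zero)))))
    · exact .const (.eps .type)
    · exact .U _
    · exact .U _

theorem typ_toCC {S : Finset SimpleType} {Γ : Ctx STTConst} {t A : Tm STTConst}
    (h : HasType (sig S) (rules S) Γ t A) : Typ (Γ.map toCC) (toCC t) (toCC A) := by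
  refine HasType.rec (motive_1 := fun _ _ => True)
    (motive_2 := fun Γ t A _ => Typ (Γ.map toCC) (toCC t) (toCC A))
    trivial ?_ ?_ ?_ ?_ ?_ ?_ ?_ ?_ h
  · intros; trivial
  · intros; exact .sort
  · intro _ _ _ _ h _
    rw [toCC_rename]
    exact .var (.of_getElem? (by simp [h]))
  · intro _ _ _ _ h _
    exact typ_constToCC h _
  · intro _ _ _ _ _ _ ihA ihB
    exact .pi ihA ihB
  · intro _ _ _ _ _ _ _ _ ihA ihB iht
    exact .lam ihA ihB iht
  · intro _ _ _ _ _ _ _ iht ihu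
    rw [toCC_inst]
    exact .app iht ihu
  · intro _ _ _ _ _ _ _ _ h ihA ihB iht
    exact .conv ihA ihB iht (conv_toCC h)

end STT

end LambdaPi

/-- In the `λΠ`-calculus modulo Simple type theory, there is no term of type `ε(x)` in the context
`x : o`; in the `λΠ`-calculus modulo the Calculus of constructions, there is no term of type
`ε_Type(x)` in the context `x : U_Type`. -/
theorem mainTheorem4 :
    (∀ S : Finset LambdaPi.SimpleType, ¬ ∃ t : LambdaPi.Tm LambdaPi.STTConst,
      (LambdaPi.STT.theory S).Typed [LambdaPi.STT.o] t (LambdaPi.STT.eps (.var 0))) ∧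
    (¬ ∃ t : LambdaPi.Tm LambdaPi.CCConst,
      LambdaPi.CC.theory.Typed [LambdaPi.CC.U .type] t (LambdaPi.CC.eps .type (.var 0))) :=
  ⟨fun _ ⟨_, h⟩ => LambdaPi.CC.not_typ_eps (LambdaPi.STT.typ_toCC h),
    fun ⟨_, h⟩ => LambdaPi.CC.not_typ_eps (LambdaPi.CC.Typ.of_hasType h)⟩
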